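/- Let $(X,d)$ be a complete and connected metric space with at least two points, and let $\mu$ be a positive complete Borel measure on $X$ (that is, a complete measure on a $\sigma$-algebra containing the Borel sets) with $0<\mu(B)<\infty$ for every open ball $B(x,r)=\{y\in X: d(x,y)<r\}$, $r>0$. Assume that $\mu$ is doubling with constant $c_\mu>1$, i.e. $\mu(B(x,2r))\le c_\mu\,\mu(B(x,r))$ for all $x\in X$ and $r>0$. Let $1<p<\infty$ and $0<\beta\le 1$. Assume that for some $\sigma>\beta p$ and $c_\sigma>0$ the quantitative reverse doubling condition \[ \frac{\mu(B(x,r))}{\mu(B(x,R))}\le c_\sigma\Bigl(\frac rR\Bigr)^{\sigma}\qquad\text{for all }x\in X,\ 0<r<R\le 2\operatorname{diam}(X)\ (r,R<\infty) \] holds, and that for some $\eta>\beta$ and $c_K>0$ the kernel estimate \[ \left|\frac{d(w,z)^\beta}{\mu(B(w,d(w,z)))}-\frac{d(y,z)^\beta}{\mu(B(y,d(y,z)))}\right|\le c_K\,\frac{d(w,y)^\eta}{d(w,z)^{\eta-\beta}\mu(B(w,d(w,z)))} \] holds for all $w,y\in X$ with $w\ne y$ and all $z\in X\setminus B(w,2d(w,y))$.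 For a measurable $f\colon X\to[0,\infty]$ let \[ I_\beta f(x)=\int_X\frac{f(y)\,d(x,y)^\beta}{\mu(B(x,d(x,y)))}\,d\mu(y),\qquad x\in X, \] and for $F\subset X$ let the Riesz $(\beta,p)$-capacity be \[ R_{\beta,p}(F)=\inf\Bigl\{\int_X f^p\,d\mu: f\colon X\to[0,\infty]\text{ measurable},\ I_\beta f\ge 1\text{ on }F\Bigr\}. \] For a bounded open set $\Omega\subset X$ and a closed set $F\subset\Omega$ let the variational Haj{\l}asz $(\beta,p)$-capacity be \[ \operatorname{cap}_{\beta,p}(F,\Omega)=\inf_u\inf_g\int_X g^p\,d\mu\quad(\inf\emptyset=\infty), \] where $u\colon X\to\mathbb R$ ranges over the $\beta$-H\"older functions (for some $\kappa\ge0$, $|u(x)-u(y)|\le\kappa\, d(x,y)^\beta$ for all $x,y\in X$) with $u\ge 1$ on $F$ and $u=0$ on $X\setminus\Omega$, and $g$ ranges over the Haj{\l}asz $\beta$-gradients of $u$, i.e. the measurable $g\colon X\to[0,\infty]$ for which there is $N\subset X$ with $\mu(N)=0$ and $|u(x)-u(y)|\le d(x,y)^\beta(g(x)+g(y))$ for all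 $x,y\in X\setminus N$. Then there is a constant $C>0$, depending only on $c_K,c_\mu,c_\sigma,\beta,\eta,\sigma,p$ (and not otherwise on $X$ or $\mu$), such that \[ C^{-1}R_{\beta,p}\bigl(E\cap\overline{B(x,r)}\bigr)\le\operatorname{cap}_{\beta,p}\bigl(E\cap\overline{B(x,r)},B(x,2r)\bigr)\le C\,R_{\beta,p}\bigl(E\cap\overline{B(x,r)}\bigr) \] whenever $E\subset X$ is closed, $x\in E$ and $0<r<\tfrac18\operatorname{diam}(X)$. Here $\overline{B(x,r)}$ is the closure of $B(x,r)$, and $\operatorname{diam}(X)$ may be infinite. -/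

import Mathlib

open MeasureTheory Metric Set
open scoped ENNReal NNReal

noncomputable section

namespace HajlaszRiesz

variable {X : Type*} [MetricSpace X] [MeasurableSpace X]

/-- Every ball has positive and finite measure. -/
def BallsPosFinite (μ : Measure X) : Prop :=
  ∀ (x : X) (r : ℝ), 0 < r → 0 < μ (ball x r) ∧ μ (ball x r) < ∞

/-- The measure `μ` is doubling with doubling constant `c`. -/
def IsDoublingWith (μ : Measure X) (c : ℝ) : Prop :=
  ∀ (x : X) (r : ℝ), 0 < r → μ (ball x (2 * r)) ≤ ENNReal.ofReal c * μ (ball x r)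

/-- The quantitative reverse doubling condition with exponent `σ` and constant `c`, for all
`0 < r < R ≤ 2 diam X`. The diameter of `X` is allowed to be infinite. -/
def IsReverseDoublingWith (μ : Measure X) (c σ : ℝ) : Prop :=
  ∀ (x : X) (r R : ℝ), 0 < r → r < R → ENNReal.ofReal R ≤ 2 * ediam (univ : Set X) →
    μ (ball x r) / μ (ball x R) ≤ ENNReal.ofReal (c * (r / R) ^ σ)

/-- The kernel estimate with exponent `η` and constant `c` for the kernel
`d(w,z)^β / μ(B(w,d(w,z)))`. The balls are assumed elsewhere to have finite positive measure,
and every radius occurring here is positive. -/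
def KernelEstimate (μ : Measure X) (β η c : ℝ) : Prop :=
  ∀ w y : X, w ≠ y → ∀ z : X, z ∉ ball w (2 * dist w y) →
    |dist w z ^ β / μ.real (ball w (dist w z)) - dist y z ^ β / μ.real (ball y (dist y z))|
      ≤ c * (dist w y ^ η / (dist w z ^ (η - β) * μ.real (ball w (dist w z))))

/-- `g : X → [0,∞]` is a Hajłasz `β`-gradient of `u : X → ℝ`: it is measurable and
`|u(x) - u(y)| ≤ d(x,y)^β (g(x) + g(y))` for all `x, y` outside a set of measure zero. -/
def IsHajlaszGradient (μ : Measure X) (β : ℝ) (u : X → ℝ) (g : X → ℝ≥0∞) : Prop :=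
  Measurable g ∧ ∃ N : Set X, μ N = 0 ∧ ∀ x ∉ N, ∀ y ∉ N,
    ENNReal.ofReal |u x - u y| ≤ ENNReal.ofReal (dist x y ^ β) * (g x + g y)

/-- The class `Lip_β(X)` of real-valued `β`-Hölder functions on `X`. -/
def LipBeta (X : Type*) [MetricSpace X] (β : ℝ) : Set (X → ℝ) :=
  {u | ∃ κ : ℝ, 0 ≤ κ ∧ ∀ x y : X, |u x - u y| ≤ κ * dist x y ^ β}

/-- The variational Hajłasz `(β,p)`-capacity of `F` relative to `Ω`; the infimum over the empty
family is `∞`. -/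
def hajlaszCapacity (μ : Measure X) (β p : ℝ) (F Ω : Set X) : ℝ≥0∞ :=
  ⨅ (u : X → ℝ) (_ : u ∈ LipBeta X β ∧ (∀ x ∈ F, 1 ≤ u x) ∧ ∀ x ∉ Ω, u x = 0)
    (g : X → ℝ≥0∞) (_ : IsHajlaszGradient μ β u g), ∫⁻ x, g x ^ p ∂μ

/-- The Riesz potential of order `β` of a nonnegative function. For `β > 0` the integrand vanishes
at `y = x`, as `0 / 0 = 0` in `ℝ≥0∞`. -/
def rieszPotential (μ : Measure X) (β : ℝ) (f : X → ℝ≥0∞) (x : X) : ℝ≥0∞ :=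
  ∫⁻ y, f y * ENNReal.ofReal (dist x y ^ β) / μ (ball x (dist x y)) ∂μ

/-- The Riesz `(β,p)`-capacity of `F`. -/
def rieszCapacity (μ : Measure X) (β p : ℝ) (F : Set X) : ℝ≥0∞ :=
  ⨅ (f : X → ℝ≥0∞) (_ : Measurable f ∧ ∀ x ∈ F, 1 ≤ rieszPotential μ β f x),
    ∫⁻ x, f x ^ p ∂μ

end HajlaszRiesz

end

/-! Both inequalities compare the potential `I_β` with Hajłasz gradients, writing `M` for the
maximal function and `F` for the compact set `E ∩ closure (ball x r)`.

Lower bound: a test function `u` vanishes on a ball `B(z,r)` with `d(x,z) = 3r`, which exists by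
connectedness. For `y ∈ F`, compare the mean of `|u - u(y)|` over that ball with the mean over
`B(y,8r)`, then telescope through the balls `B(y, 8r/2^k)`. This bounds `|u(y)|` by a sum of scaled
means of the gradient `g`, and reverse doubling bounds the sum by a multiple of `I_β g(y)`
(`ofReal_abs_le_rieszPotential`). So a fixed multiple of `g` is admissible for the Riesz capacity.

Upper bound: let `f` be admissible for the Riesz capacity. By compactness of `F`, it may be replaced
by twice a truncation `h` that is bounded and vanishes outside a ball. The kernel estimate shows
that `I_β h` has a gradient comparable to `M h` (`IsDoublingWith.rieszPotential_le_add`), so `I_β h`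
times a cutoff is a test function with gradient `K M h + r^(-β) I_β h` on `B(x,2r)`. The first term
is controlled in `L^p` by the maximal theorem. For the second, the part of the potential near the
pole is again bounded by `M h`, and the far part by Hölder and reverse doubling, whose annular
series converges because `σ > βp` (`IsDoublingWith.setLIntegral_rieszPotential_rpow_le`). -/

namespace HajlaszRiesz

variable {X : Type*} [MetricSpace X] [MeasurableSpace X] {μ : Measure X} {c : ℝ}

/-! ### Doubling measures: balls are totally bounded. -/

section Doubling

theorem IsDoublingWith.measure_ball_pow (hd : IsDoublingWith μ c) (x : X) {r : ℝ} (hr : 0 < r)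
    (n : ℕ) : μ (ball x (2 ^ n * r)) ≤ ENNReal.ofReal c ^ n * μ (ball x r) := by
  induction n with
  | zero => simp
  | succ n ih =>
    calc μ (ball x (2 ^ (n + 1) * r)) = μ (ball x (2 * (2 ^ n * r))) := by ring_nf
      _ ≤ ENNReal.ofReal c * μ (ball x (2 ^ n * r)) := hd x _ (by positivity)
      _ ≤ ENNReal.ofReal c * (ENNReal.ofReal c ^ n * μ (ball x r)) := by gcongr
      _ = _ := by ring

theorem IsDoublingWith.measure_ball_le (hd : IsDoublingWith μ c) {x y : X} {r s : ℝ} (hr : 0 < r)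
    (n : ℕ) (h : s + dist x y ≤ 2 ^ n * r) :
    μ (ball x s) ≤ ENNReal.ofReal c ^ n * μ (ball y r) :=
  (measure_mono (ball_subset_ball' h)).trans (hd.measure_ball_pow y hr n)

/-- Disjoint balls of radius `ε/6` centred in `B(x,R)` each carry a fixed fraction of `μ(B(x,R))` by
doubling and lie in one ball of finite measure, so there are finitely many. The Vitali enlargement
by `5` keeps the covering radius at `5ε/6 < ε`. -/
theorem IsDoublingWith.totallyBounded_ball [OpensMeasurableSpace X] (hb : BallsPosFinite μ)
    (hd : IsDoublingWith μ c) (x : X) (R : ℝ) : TotallyBounded (ball x R) := by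
  rw [Metric.totallyBounded_iff]
  intro ε hε
  rcases le_or_gt R 0 with hR | hR
  · exact ⟨∅, finite_empty, by simp [ball_eq_empty.2 hR]⟩
  obtain ⟨u, hut, hdis, hcov⟩ := Vitali.exists_disjoint_subfamily_covering_enlargement_closedBall
    (ball x R) (fun y : X => y) (fun _ => ε / 6) (ε / 6) (fun _ _ => le_rfl) 5 (by norm_num)
  refine ⟨u, ?_, ?_⟩
  · obtain ⟨n, hn⟩ := pow_unbounded_of_one_lt ((R + R) / (ε / 6)) (one_lt_two : (1 : ℝ) < 2)
    have hn' : R + R ≤ 2 ^ n * (ε / 6) := by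
      rw [div_lt_iff₀ (by positivity)] at hn; exact hn.le
    have hsub : (⋃ y : u, ball (y : X) (ε / 6)) ⊆ ball x (ε / 6 + R) := by
      refine iUnion_subset fun y => ball_subset_ball' ?_
      have := mem_ball.1 (hut y.2)
      linarith
    have hfin := Measure.finite_const_le_meas_of_disjoint_iUnion (ι := u) μ
      (ε := μ (ball x R) / ENNReal.ofReal c ^ n) (As := fun y => ball (y : X) (ε / 6))
      (ENNReal.div_pos (hb x R hR).1.ne' (by finiteness)) (fun _ => measurableSet_ball)
      (fun a b hab => (hdis a.2 b.2 (fun h => hab (Subtype.ext h))).mono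
        ball_subset_closedBall ball_subset_closedBall)
      ((measure_mono hsub).trans_lt (hb x _ (by positivity)).2).ne
    have huniv : {i : u | μ (ball x R) / ENNReal.ofReal c ^ n ≤ μ (ball (i : X) (ε / 6))} =
        univ := by
      refine eq_univ_of_forall fun y => ?_
      refine ENNReal.div_le_of_le_mul' (hd.measure_ball_le (by positivity) n ?_)
      have := mem_ball.1 (hut y.2)
      rw [dist_comm] at this
      linarith
    rw [huniv] at hfin
    exact Set.finite_coe_iff.1 (Set.finite_univ_iff.1 hfin)
  · intro a ha
    obtain ⟨b, hb, hab⟩ := hcov a ha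
    refine mem_iUnion₂.2 ⟨b, hb, ?_⟩
    have := hab (mem_closedBall_self (by positivity))
    rw [mem_closedBall] at this
    rw [mem_ball]; linarith

/-- Properness makes the set in the capacity compact and provides the second countability needed for
the maximal theorem. -/
theorem IsDoublingWith.properSpace [OpensMeasurableSpace X] [CompleteSpace X]
    (hb : BallsPosFinite μ) (hd : IsDoublingWith μ c) : ProperSpace X :=
  ⟨fun x r => isCompact_iff_totallyBounded_isComplete.2 ⟨
    ((hd.totallyBounded_ball hb x (r + 1)).subset (closedBall_subset_ball (by linarith))),
      isClosed_closedBall.isComplete⟩⟩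

end Doubling

/-! ### The maximal theorem. -/

section MaximalFunction

/-- The uncentred Hardy–Littlewood maximal function over open balls. -/
noncomputable def maximalFunction (μ : Measure X) (f : X → ℝ≥0∞) (x : X) : ℝ≥0∞ :=
  ⨆ (y : X) (s : ℝ) (_ : 0 < s ∧ x ∈ ball y s), (∫⁻ z in ball y s, f z ∂μ) / μ (ball y s)

theorem lt_maximalFunction_iff {f : X → ℝ≥0∞} {t : ℝ≥0∞} {x : X} :
    t < maximalFunction μ f x ↔ ∃ (y : X) (s : ℝ), (0 < s ∧ x ∈ ball y s) ∧
      t < (∫⁻ z in ball y s, f z ∂μ) / μ (ball y s) := by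
  simp only [maximalFunction, lt_iSup_iff, exists_prop]

/-- Because the supremum is uncentred, superlevel sets are unions of open balls; `f` need not be
measurable. -/
theorem measurable_maximalFunction [OpensMeasurableSpace X] (f : X → ℝ≥0∞) :
    Measurable (maximalFunction μ f) := by
  refine measurable_of_Ioi fun t => IsOpen.measurableSet ?_
  rw [isOpen_iff_mem_nhds]
  intro x hx
  obtain ⟨y, s, ⟨hs, hxy⟩, h⟩ := lt_maximalFunction_iff.1 hx
  filter_upwards [isOpen_ball.mem_nhds hxy] with z hz
  exact lt_maximalFunction_iff.2 ⟨y, s, ⟨hs, hz⟩, h⟩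

theorem setLIntegral_ball_le_maximalFunction (hb : BallsPosFinite μ) (f : X → ℝ≥0∞) {x y : X}
    {s : ℝ} (hx : x ∈ ball y s) :
    ∫⁻ z in ball y s, f z ∂μ ≤ maximalFunction μ f x * μ (ball y s) := by
  have hs := pos_of_mem_ball hx
  rw [← ENNReal.div_le_iff (hb y s hs).1.ne' (hb y s hs).2.ne]
  exact le_iSup₂_of_le y s (le_iSup_of_le ⟨hs, hx⟩ le_rfl)

theorem maximalFunction_le {f : X → ℝ≥0∞} {b : ℝ≥0∞} (hf : ∀ x, f x ≤ b) (x : X) :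
    maximalFunction μ f x ≤ b := by
  refine iSup₂_le fun y s => iSup_le fun _ => ENNReal.div_le_of_le_mul ?_
  calc ∫⁻ z in ball y s, f z ∂μ ≤ ∫⁻ z in ball y s, b ∂μ := lintegral_mono hf
    _ = b * μ (ball y s) := by simp

/-- This serves to discard the part of `f` below height `t/2` in the proof of the strong-type bound.
-/
theorem maximalFunction_add_const_le (f g : X → ℝ≥0∞) {b : ℝ≥0∞}
    (hfg : ∀ x, f x ≤ g x + b) (x : X) :
    maximalFunction μ f x ≤ maximalFunction μ g x + b := by
  refine iSup₂_le fun y s => iSup_le fun hs => ?_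
  calc (∫⁻ z in ball y s, f z ∂μ) / μ (ball y s)
      ≤ (∫⁻ z in ball y s, (g z + b) ∂μ) / μ (ball y s) := by gcongr; exact hfg _
    _ = (∫⁻ z in ball y s, g z ∂μ) / μ (ball y s) + b * μ (ball y s) / μ (ball y s) := by
        rw [lintegral_add_right _ measurable_const, ENNReal.add_div]; simp
    _ ≤ _ := by
        gcongr
        · exact le_iSup₂_of_le (f := fun y s => ⨆ (_ : 0 < s ∧ x ∈ ball y s),
            (∫⁻ z in ball y s, g z ∂μ) / μ (ball y s)) y s (le_iSup_of_le hs le_rfl)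
        · exact ENNReal.div_le_of_le_mul le_rfl

/-- Weak type (1,1) by Vitali covering. The covering lemma needs bounded radii, so the superlevel
set is exhausted by balls of radius at most `n`. The closed enlargement by `5` sits in the open one
by `8 = 2^3`, whence `c^3`. -/
theorem IsDoublingWith.mul_measure_lt_maximalFunction_le [OpensMeasurableSpace X]
    [SecondCountableTopology X] (hb : BallsPosFinite μ) (hd : IsDoublingWith μ c)
    (f : X → ℝ≥0∞) (t : ℝ≥0∞) :
    t * μ {x | t < maximalFunction μ f x} ≤ ENNReal.ofReal c ^ 3 * ∫⁻ x, f x ∂μ := by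
  set T : ℕ → Set (X × ℝ) := fun n => {a | 0 < a.2 ∧ a.2 ≤ n ∧
    t < (∫⁻ z in ball a.1 a.2, f z ∂μ) / μ (ball a.1 a.2)} with hT
  have hset : {x | t < maximalFunction μ f x} = ⋃ n, ⋃ a ∈ T n, ball a.1 a.2 := by
    ext x
    simp only [mem_ofPred_eq, lt_maximalFunction_iff, mem_iUnion, hT, exists_prop]
    constructor
    · rintro ⟨y, s, ⟨hs, hx⟩, h⟩
      obtain ⟨n, hn⟩ := exists_nat_ge s
      exact ⟨n, (y, s), ⟨hs, hn, h⟩, hx⟩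
    · rintro ⟨n, a, ⟨hs, -, h⟩, hx⟩
      exact ⟨a.1, a.2, ⟨hs, hx⟩, h⟩
  have hmono : Monotone fun n => ⋃ a ∈ T n, ball a.1 a.2 := by
    intro m n hmn
    refine biUnion_subset_biUnion_left fun a ha =>
      ⟨ha.1, ha.2.1.trans (by exact_mod_cast hmn), ha.2.2⟩
  rw [hset, hmono.measure_iUnion, ENNReal.mul_iSup]
  refine iSup_le fun n => ?_
  obtain ⟨u, hut, hdis, hcov⟩ := Vitali.exists_disjoint_subfamily_covering_enlargement_closedBall
    (T n) (fun a => a.1) (fun a => a.2) n (fun a ha => ha.2.1) 5 (by norm_num)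
  have hdis' : u.PairwiseDisjoint fun a => ball a.1 a.2 := fun a ha b hb hab =>
    (hdis ha hb hab).mono ball_subset_closedBall ball_subset_closedBall
  have hu : u.Countable := hdis'.countable_of_isOpen (fun _ _ => isOpen_ball)
    (fun a ha => nonempty_ball.2 (hut ha).1)
  have hsub : (⋃ a ∈ T n, ball a.1 a.2) ⊆ ⋃ a ∈ u, ball a.1 (2 ^ 3 * a.2) := by
    refine iUnion₂_subset fun a ha => ?_
    obtain ⟨b, hbu, hab⟩ := hcov a ha
    refine (ball_subset_closedBall.trans (hab.trans (closedBall_subset_ball ?_))).trans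
      (subset_biUnion_of_mem (u := fun a : X × ℝ => ball a.1 (2 ^ 3 * a.2)) hbu)
    linarith [(hut hbu).1]
  calc t * μ (⋃ a ∈ T n, ball a.1 a.2)
      ≤ t * ∑' a : u, μ (ball a.1.1 (2 ^ 3 * a.1.2)) := by
        gcongr
        exact (measure_mono hsub).trans (measure_biUnion_le μ hu _)
    _ = ∑' a : u, t * μ (ball a.1.1 (2 ^ 3 * a.1.2)) := ENNReal.tsum_mul_left.symm
    _ ≤ ∑' a : u, ENNReal.ofReal c ^ 3 * ∫⁻ z in ball a.1.1 a.1.2, f z ∂μ := by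
        refine ENNReal.tsum_le_tsum fun a => ?_
        have ha := hut a.2
        have h1 := (hb a.1.1 a.1.2 ha.1)
        have h2 := (ENNReal.lt_div_iff_mul_lt (Or.inl h1.1.ne') (Or.inl h1.2.ne)).1 ha.2.2
        calc t * μ (ball a.1.1 (2 ^ 3 * a.1.2))
            ≤ t * (ENNReal.ofReal c ^ 3 * μ (ball a.1.1 a.1.2)) := by
              gcongr; exact hd.measure_ball_pow _ ha.1 3
          _ = ENNReal.ofReal c ^ 3 * (t * μ (ball a.1.1 a.1.2)) := by ring
          _ ≤ _ := by gcongr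
    _ = ENNReal.ofReal c ^ 3 * ∫⁻ z in ⋃ a ∈ u, ball a.1 a.2, f z ∂μ := by
        rw [ENNReal.tsum_mul_left, lintegral_biUnion hu (fun _ _ => measurableSet_ball) hdis']
    _ ≤ _ := mul_le_mul' le_rfl (setLIntegral_le_lintegral _ _)

/-- The maximal theorem on `L^p` for bounded functions. -/
theorem IsDoublingWith.lintegral_maximalFunction_rpow_le [OpensMeasurableSpace X]
    [SecondCountableTopology X] (hb : BallsPosFinite μ) (hd : IsDoublingWith μ c) {p : ℝ}
    (hp : 1 < p) {f : X → ℝ≥0∞} (hf : Measurable f) {b : ℝ≥0∞} (hbt : b ≠ ∞)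
    (hfb : ∀ x, f x ≤ b) :
    ∫⁻ x, maximalFunction μ f x ^ p ∂μ ≤
      ENNReal.ofReal p * (2 * ENNReal.ofReal c ^ 3) * (ENNReal.ofReal (p - 1))⁻¹ * 2 ^ (p - 1) *
        ∫⁻ x, f x ^ p ∂μ := by
  have hp0 : 0 < p := by linarith
  have hp1 : 0 < p - 1 := by linarith
  set M := maximalFunction μ f with hM
  have hMt : ∀ x, M x ≠ ∞ := fun x => ((maximalFunction_le hfb x).trans_lt hbt.lt_top).ne
  have hft : ∀ x, f x ≠ ∞ := fun x => ((hfb x).trans_lt hbt.lt_top).ne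
  have hMm : Measurable M := measurable_maximalFunction f
  -- Marcinkiewicz splitting at height `t/2`. Viewing the integral of `f` over `{t < 2f}` as a
  -- measure with density `f` lets the layer-cake formula with exponent `p - 1` replace an explicit
  -- use of Fubini.
  have key : ∀ t ∈ Ioi (0 : ℝ), μ {x | t < (M x).toReal} * ENNReal.ofReal (t ^ (p - 1)) ≤
      2 * ENNReal.ofReal c ^ 3 * (μ.withDensity f {x | t < 2 * (f x).toReal} *
        ENNReal.ofReal (t ^ (p - 1 - 1))) := by
    intro t ht
    have ht : 0 < t := ht
    set S : Set X := {x | t < 2 * (f x).toReal} with hS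
    have hSm : MeasurableSet S :=
      measurableSet_lt measurable_const ((hf.ennreal_toReal).const_mul 2)
    have h1 : {x | t < (M x).toReal} ⊆
        {x | ENNReal.ofReal (t / 2) < maximalFunction μ (S.indicator f) x} := by
      intro x hx
      have hx : t < (M x).toReal := hx
      by_contra hcon
      have hcon : maximalFunction μ (S.indicator f) x ≤ ENNReal.ofReal (t / 2) := not_lt.1 hcon
      have h2 : M x ≤ maximalFunction μ (S.indicator f) x + ENNReal.ofReal (t / 2) := by
        refine maximalFunction_add_const_le f _ (fun z => ?_) x
        by_cases hz : z ∈ S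
        · simp [hz]
        · have : ¬ t < 2 * (f z).toReal := hz
          simp only [hz, not_false_eq_true, indicator_of_notMem, zero_add]
          rw [← ENNReal.ofReal_toReal (hft z)]
          exact ENNReal.ofReal_le_ofReal (by linarith)
      have h3 : M x ≤ ENNReal.ofReal t := by
        refine h2.trans ((add_le_add_left hcon _).trans ?_)
        rw [← ENNReal.ofReal_add (by positivity) (by positivity)]
        simp
      have := ENNReal.toReal_le_of_le_ofReal ht.le h3
      linarith
    have h2 : ENNReal.ofReal (t / 2) * μ {x | t < (M x).toReal} ≤
        ENNReal.ofReal c ^ 3 * μ.withDensity f S := by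
      rw [withDensity_apply _ hSm, ← lintegral_indicator hSm]
      refine le_trans ?_ (hd.mul_measure_lt_maximalFunction_le hb (S.indicator f)
        (ENNReal.ofReal (t / 2)))
      gcongr
    calc μ {x | t < (M x).toReal} * ENNReal.ofReal (t ^ (p - 1))
        = 2 * (ENNReal.ofReal (t / 2) * μ {x | t < (M x).toReal}) *
            ENNReal.ofReal (t ^ (p - 1 - 1)) := by
          have : t ^ (p - 1) = 2 * (t / 2) * t ^ (p - 1 - 1) := by
            rw [Real.rpow_sub_one ht.ne' (p - 1)]; field_simp
          rw [this, ENNReal.ofReal_mul (by positivity), ENNReal.ofReal_mul (by positivity)]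
          simp only [ENNReal.ofReal_ofNat]
          ring
      _ ≤ 2 * (ENNReal.ofReal c ^ 3 * μ.withDensity f S) * ENNReal.ofReal (t ^ (p - 1 - 1)) := by
          gcongr
      _ = _ := by ring
  have e1 : ∫⁻ x, M x ^ p ∂μ = ∫⁻ x, ENNReal.ofReal ((M x).toReal ^ p) ∂μ := by
    refine lintegral_congr fun x => ?_
    rw [← ENNReal.ofReal_rpow_of_nonneg ENNReal.toReal_nonneg hp0.le,
      ENNReal.ofReal_toReal (hMt x)]
  have e2 : ∫⁻ x, ENNReal.ofReal ((2 * (f x).toReal) ^ (p - 1)) ∂(μ.withDensity f) =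
      2 ^ (p - 1) * ∫⁻ x, f x ^ p ∂μ := by
    have hm : Measurable fun x => ENNReal.ofReal ((2 * (f x).toReal) ^ (p - 1)) :=
      ENNReal.measurable_ofReal.comp (((hf.ennreal_toReal).const_mul 2).pow_const _)
    rw [lintegral_withDensity_eq_lintegral_mul _ hf hm,
      ← lintegral_const_mul _ (hf.pow_const p)]
    refine lintegral_congr fun x => ?_
    simp only [Pi.mul_apply]
    rw [← ENNReal.ofReal_rpow_of_nonneg (by positivity) hp1.le, ENNReal.ofReal_mul (by norm_num),
      ENNReal.ofReal_toReal (hft x), ENNReal.mul_rpow_of_nonneg _ _ hp1.le]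
    have : f x ^ p = f x * f x ^ (p - 1) := by
      conv_lhs => rw [show p = 1 + (p - 1) by ring]
      rw [ENNReal.rpow_add_of_nonneg _ _ zero_le_one hp1.le, ENNReal.rpow_one]
    rw [this, ENNReal.ofReal_ofNat]
    ring
  have e3 := lintegral_rpow_eq_lintegral_meas_lt_mul (μ.withDensity f)
    (f := fun x => 2 * (f x).toReal) (Filter.Eventually.of_forall fun x => by positivity)
    ((hf.ennreal_toReal).const_mul 2).aemeasurable hp1
  rw [e2] at e3
  rw [e1, lintegral_rpow_eq_lintegral_meas_lt_mul μ
    (Filter.Eventually.of_forall fun x => ENNReal.toReal_nonneg)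
    (hMm.ennreal_toReal).aemeasurable hp0]
  have h0 : ENNReal.ofReal (p - 1) ≠ 0 := by simpa using hp1
  calc ENNReal.ofReal p * ∫⁻ t in Ioi (0 : ℝ), μ {x | t < (M x).toReal} *
        ENNReal.ofReal (t ^ (p - 1))
      ≤ ENNReal.ofReal p * ∫⁻ t in Ioi (0 : ℝ), 2 * ENNReal.ofReal c ^ 3 *
        (μ.withDensity f {x | t < 2 * (f x).toReal} * ENNReal.ofReal (t ^ (p - 1 - 1))) := by
        exact mul_le_mul' le_rfl (setLIntegral_mono' measurableSet_Ioi key)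
    _ = ENNReal.ofReal p * (2 * ENNReal.ofReal c ^ 3) * (ENNReal.ofReal (p - 1))⁻¹ *
        (ENNReal.ofReal (p - 1) * ∫⁻ t in Ioi (0 : ℝ),
          μ.withDensity f {x | t < 2 * (f x).toReal} * ENNReal.ofReal (t ^ (p - 1 - 1))) := by
        rw [lintegral_const_mul' _ _ (by finiteness)]
        rw [mul_assoc _ _ (ENNReal.ofReal (p - 1) * _), ← mul_assoc (ENNReal.ofReal (p - 1))⁻¹,
          ENNReal.inv_mul_cancel h0 ENNReal.ofReal_ne_top, one_mul, ← mul_assoc]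
    _ = _ := by rw [← e3]; ring

end MaximalFunction

/-! ### Dyadic annuli estimates for the Riesz kernel. -/

section Annuli

/-- The kernel of the Riesz potential of order `β`. -/
noncomputable def rieszKernel (μ : Measure X) (β : ℝ) (y z : X) : ℝ≥0∞ :=
  ENNReal.ofReal (dist y z ^ β) / μ (ball y (dist y z))

theorem rieszPotential_eq (β : ℝ) (f : X → ℝ≥0∞) (y : X) :
    rieszPotential μ β f y = ∫⁻ z, f z * rieszKernel μ β y z ∂μ := by
  simp only [rieszPotential, rieszKernel, mul_div_assoc]

theorem rieszKernel_self {β : ℝ} (hβ : 0 < β) (y : X) : rieszKernel μ β y y = 0 := by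
  simp [rieszKernel, Real.zero_rpow hβ.ne']

theorem measurable_measure_ball_dist [OpensMeasurableSpace X] (y : X) :
    Measurable fun z => μ (ball y (dist y z)) := by
  have : Monotone fun t => μ (ball y t) := fun s t h => measure_mono (ball_subset_ball h)
  exact this.measurable.comp (continuous_const.dist continuous_id).measurable

theorem measurable_rieszKernel [OpensMeasurableSpace X] (β : ℝ) (y : X) :
    Measurable (rieszKernel μ β y) :=
  (((continuous_const.dist continuous_id).measurable.pow_const β).ennreal_ofReal).div
    (measurable_measure_ball_dist y)

theorem measurable_mul_rieszKernel [OpensMeasurableSpace X] (β : ℝ) {f : X → ℝ≥0∞}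
    (hf : Measurable f) (y : X) : Measurable fun z => f z * rieszKernel μ β y z :=
  hf.mul (measurable_rieszKernel β y)

/-- The sum of the geometric series with ratio `2 ^ (-θ)`. -/
noncomputable def geomSum (θ : ℝ) : ℝ≥0∞ := ∑' n : ℕ, ENNReal.ofReal ((2 : ℝ) ^ (-θ)) ^ n

theorem geomSum_ne_top {θ : ℝ} (hθ : 0 < θ) : geomSum θ ≠ ∞ := by
  rw [geomSum, ENNReal.tsum_geometric, ENNReal.inv_ne_top, ← pos_iff_ne_zero, tsub_pos_iff_lt]
  rw [← ENNReal.ofReal_one, ENNReal.ofReal_lt_ofReal_iff one_pos]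
  exact Real.rpow_lt_one_of_one_lt_of_neg one_lt_two (by linarith)

theorem div_two_pow_rpow {R : ℝ} (hR : 0 < R) (n : ℕ) (θ : ℝ) :
    (R / 2 ^ n) ^ θ = R ^ θ * ((2 : ℝ) ^ (-θ)) ^ n := by
  rw [Real.div_rpow hR.le (by positivity), ← Real.rpow_natCast, ← Real.rpow_mul (by norm_num),
    ← Real.rpow_natCast, ← Real.rpow_mul (by norm_num), div_eq_mul_inv,
    ← Real.rpow_neg (by norm_num)]
  ring_nf

theorem two_pow_mul_rpow {R : ℝ} (hR : 0 < R) (n : ℕ) (θ : ℝ) :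
    (2 ^ n * R) ^ θ = R ^ θ * ((2 : ℝ) ^ θ) ^ n := by
  rw [Real.mul_rpow (by positivity) hR.le, ← Real.rpow_natCast, ← Real.rpow_mul (by norm_num),
    ← Real.rpow_natCast, ← Real.rpow_mul (by norm_num)]
  ring_nf

theorem exists_div_two_pow_le_lt {d R : ℝ} (hd : 0 < d) (h : d < R) :
    ∃ n : ℕ, R / 2 ^ (n + 1) ≤ d ∧ d < R / 2 ^ n := by
  have hex : ∃ n : ℕ, R / 2 ^ (n + 1) ≤ d := by
    obtain ⟨n, hn⟩ := pow_unbounded_of_one_lt (R / d) (one_lt_two : (1 : ℝ) < 2)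
    refine ⟨n, ?_⟩
    rw [div_lt_iff₀ hd] at hn
    rw [div_le_iff₀ (by positivity), pow_succ]
    nlinarith
  classical
  refine ⟨Nat.find hex, Nat.find_spec hex, ?_⟩
  rcases hn : Nat.find hex with _ | m
  · simpa using h
  · exact not_le.1 (Nat.find_min hex (m := m) (by omega))

theorem exists_two_pow_mul_le_lt {d R : ℝ} (hR : 0 < R) (h : R ≤ d) :
    ∃ n : ℕ, 2 ^ n * R ≤ d ∧ d < 2 ^ (n + 1) * R := by
  obtain ⟨n, h1, h2⟩ := exists_nat_pow_near (x := d / R) (y := 2) ((one_le_div hR).2 h)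
    (by norm_num)
  exact ⟨n, (le_div_iff₀ hR).1 h1, (div_lt_iff₀ hR).1 h2⟩

/-- Splitting an integral along a countable cover on whose members the kernel is bounded. -/
theorem setLIntegral_mul_le_tsum {α : Type*} [MeasurableSpace α] {ν : Measure α}
    {f : α → ℝ≥0∞} (hf : Measurable f) {S : Set α}
    (hS : MeasurableSet S) {B : ℕ → Set α} (hB : ∀ n, MeasurableSet (B n)) {k : α → ℝ≥0∞}
    {A : ℕ → ℝ≥0∞} (h : ∀ z ∈ S, k z = 0 ∨ ∃ n, z ∈ B n ∧ k z ≤ A n) :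
    ∫⁻ z in S, f z * k z ∂ν ≤ ∑' n, A n * ∫⁻ z in B n, f z ∂ν := by
  calc ∫⁻ z in S, f z * k z ∂ν
      ≤ ∫⁻ z, ∑' n, (B n).indicator (fun z => A n * f z) z ∂ν := by
        rw [← lintegral_indicator hS]
        refine lintegral_mono fun z => ?_
        by_cases hz : z ∈ S
        · rw [indicator_of_mem hz]
          rcases h z hz with h0 | ⟨n, hn, hk⟩
          · simp [h0]
          · refine le_trans ?_ (ENNReal.le_tsum n)
            rw [indicator_of_mem hn, mul_comm]
            gcongr
        · simp [hz]
    _ = ∑' n, A n * ∫⁻ z in B n, f z ∂ν := by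
        rw [lintegral_tsum fun n => ((hf.const_mul _).indicator (hB n)).aemeasurable]
        refine tsum_congr fun n => ?_
        rw [lintegral_indicator (hB n), lintegral_const_mul _ hf]

theorem IsDoublingWith.setLIntegral_ball_div_le (hb : BallsPosFinite μ) (hd : IsDoublingWith μ c)
    (f : X → ℝ≥0∞) (w : X) {r : ℝ} (hr : 0 < r) :
    (∫⁻ z in ball w (2 * r), f z ∂μ) / μ (ball w r) ≤
      ENNReal.ofReal c * maximalFunction μ f w := by
  refine ENNReal.div_le_of_le_mul ?_
  calc ∫⁻ z in ball w (2 * r), f z ∂μ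
      ≤ maximalFunction μ f w * μ (ball w (2 * r)) :=
        setLIntegral_ball_le_maximalFunction hb f (mem_ball_self (by positivity))
    _ ≤ maximalFunction μ f w * (ENNReal.ofReal c * μ (ball w r)) := by gcongr; exact hd w r hr
    _ = _ := by ring

/-- Hedberg's estimate: on the `n`-th annulus shrinking to `w`, doubling bounds the contribution by
`(R/2^n)^β` times `c M f(w)`, and these sum geometrically. -/
theorem IsDoublingWith.setLIntegral_ball_mul_rieszKernel_le [OpensMeasurableSpace X]
    (hb : BallsPosFinite μ) (hd : IsDoublingWith μ c) {β : ℝ} (hβ : 0 < β) {f : X → ℝ≥0∞}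
    (hf : Measurable f) (w : X) {R : ℝ} (hR : 0 < R) :
    ∫⁻ z in ball w R, f z * rieszKernel μ β w z ∂μ ≤
      ENNReal.ofReal c * geomSum β * ENNReal.ofReal (R ^ β) * maximalFunction μ f w := by
  calc ∫⁻ z in ball w R, f z * rieszKernel μ β w z ∂μ
      ≤ ∑' n : ℕ, ENNReal.ofReal ((R / 2 ^ n) ^ β) / μ (ball w (R / 2 ^ (n + 1))) *
          ∫⁻ z in ball w (R / 2 ^ n), f z ∂μ := by
        refine setLIntegral_mul_le_tsum hf measurableSet_ball (fun n => measurableSet_ball) ?_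
        intro z hz
        rcases eq_or_ne w z with rfl | hwz
        · exact Or.inl (rieszKernel_self hβ w)
        rw [mem_ball'] at hz
        obtain ⟨n, h1, h2⟩ := exists_div_two_pow_le_lt (dist_pos.2 hwz) hz
        refine Or.inr ⟨n, mem_ball'.2 h2, ?_⟩
        unfold rieszKernel
        gcongr
    _ ≤ ∑' n : ℕ, ENNReal.ofReal (R ^ β) * ENNReal.ofReal c * maximalFunction μ f w *
          ENNReal.ofReal ((2 : ℝ) ^ (-β)) ^ n := by
        refine ENNReal.tsum_le_tsum fun n => ?_
        have := hd.setLIntegral_ball_div_le hb f w (r := R / 2 ^ (n + 1)) (by positivity)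
        rw [show 2 * (R / 2 ^ (n + 1)) = R / 2 ^ n by rw [pow_succ]; field_simp] at this
        calc _ = ENNReal.ofReal ((R / 2 ^ n) ^ β) *
              ((∫⁻ z in ball w (R / 2 ^ n), f z ∂μ) / μ (ball w (R / 2 ^ (n + 1)))) := by
              simp only [div_eq_mul_inv]; ring
          _ ≤ ENNReal.ofReal ((R / 2 ^ n) ^ β) * (ENNReal.ofReal c * maximalFunction μ f w) := by
              gcongr
          _ = _ := by
              rw [div_two_pow_rpow hR, ENNReal.ofReal_mul (by positivity),
                ENNReal.ofReal_pow (by positivity)]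
              ring
    _ = _ := by rw [ENNReal.tsum_mul_left, geomSum]; ring

/-- The same summation over growing annuli. With `θ = η - β` it handles the error term in the kernel
estimate. -/
theorem IsDoublingWith.setLIntegral_compl_ball_mul_le [OpensMeasurableSpace X]
    (hb : BallsPosFinite μ) (hd : IsDoublingWith μ c) {θ : ℝ} (hθ : 0 < θ) {f : X → ℝ≥0∞}
    (hf : Measurable f) (w : X) {R : ℝ} (hR : 0 < R) :
    ∫⁻ z in (ball w R)ᶜ, f z * (ENNReal.ofReal (dist w z ^ (-θ)) / μ (ball w (dist w z))) ∂μ ≤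
      ENNReal.ofReal c * geomSum θ * ENNReal.ofReal (R ^ (-θ)) * maximalFunction μ f w := by
  calc ∫⁻ z in (ball w R)ᶜ, f z * (ENNReal.ofReal (dist w z ^ (-θ)) / μ (ball w (dist w z))) ∂μ
      ≤ ∑' n : ℕ, ENNReal.ofReal ((2 ^ n * R) ^ (-θ)) / μ (ball w (2 ^ n * R)) *
          ∫⁻ z in ball w (2 ^ (n + 1) * R), f z ∂μ := by
        refine setLIntegral_mul_le_tsum hf measurableSet_ball.compl (fun n => measurableSet_ball) ?_
        intro z hz
        rw [mem_compl_iff, mem_ball', not_lt] at hz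
        obtain ⟨n, h1, h2⟩ := exists_two_pow_mul_le_lt hR hz
        refine Or.inr ⟨n, mem_ball'.2 h2, ?_⟩
        have h3 : dist w z ^ (-θ) ≤ (2 ^ n * R) ^ (-θ) :=
          Real.rpow_le_rpow_of_nonpos (by positivity) h1 (by linarith)
        gcongr
    _ ≤ ∑' n : ℕ, ENNReal.ofReal (R ^ (-θ)) * ENNReal.ofReal c * maximalFunction μ f w *
          ENNReal.ofReal ((2 : ℝ) ^ (-θ)) ^ n := by
        refine ENNReal.tsum_le_tsum fun n => ?_
        have := hd.setLIntegral_ball_div_le hb f w (r := 2 ^ n * R) (by positivity)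
        rw [show 2 * (2 ^ n * R) = 2 ^ (n + 1) * R by ring] at this
        calc _ = ENNReal.ofReal ((2 ^ n * R) ^ (-θ)) *
              ((∫⁻ z in ball w (2 ^ (n + 1) * R), f z ∂μ) / μ (ball w (2 ^ n * R))) := by
              simp only [div_eq_mul_inv]; ring
          _ ≤ ENNReal.ofReal ((2 ^ n * R) ^ (-θ)) *
              (ENNReal.ofReal c * maximalFunction μ f w) := by
              gcongr
          _ = _ := by
              rw [two_pow_mul_rpow hR, ENNReal.ofReal_mul (by positivity),
                ENNReal.ofReal_pow (by positivity)]
              ring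
    _ = _ := by rw [ENNReal.tsum_mul_left, geomSum]; ring

theorem setLIntegral_le_rpow_mul {α : Type*} [MeasurableSpace α] {ν : Measure α}
    {p : ℝ} (hp : 1 < p) {f : α → ℝ≥0∞} (hf : Measurable f) (S : Set α) :
    ∫⁻ z in S, f z ∂ν ≤ (∫⁻ z, f z ^ p ∂ν) ^ (1 / p) * ν S ^ (1 - 1 / p) := by
  have hpq := Real.HolderConjugate.conjExponent hp
  have h := ENNReal.lintegral_mul_le_Lp_mul_Lq (ν.restrict S) hpq hf.aemeasurable
    (g := fun _ => 1) aemeasurable_const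
  have hq : 1 / Real.conjExponent p = 1 - 1 / p := by
    have := hpq.inv_add_inv_eq_one
    simp only [one_div]; linarith
  rw [hq] at h
  simp only [Pi.mul_apply, mul_one, ENNReal.one_rpow, lintegral_const, one_mul,
    Measure.restrict_apply_univ] at h
  refine h.trans (mul_le_mul' (ENNReal.rpow_le_rpow (setLIntegral_le_lintegral _ _) ?_) le_rfl)
  positivity

/-- The `L^p` bound for the part of the Riesz potential far from the pole. -/
theorem IsDoublingWith.setLIntegral_compl_ball_mul_rieszKernel_le [OpensMeasurableSpace X]
    (hb : BallsPosFinite μ) (hd : IsDoublingWith μ c) {cσ σ β p : ℝ} (hcσ : 0 < cσ)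
    (hrd : IsReverseDoublingWith μ cσ σ) (hβ : 0 < β) (hp : 1 < p)
    {f : X → ℝ≥0∞} (hf : Measurable f) (y : X) {R : ℝ} (hR : 0 < R) :
    ∫⁻ z in (ball y R)ᶜ, f z * rieszKernel μ β y z ∂μ ≤
      ENNReal.ofReal c * ENNReal.ofReal (cσ ^ (1 / p)) * geomSum (σ / p - β) *
        (ENNReal.ofReal (2 ^ (β - σ / p)) * ENNReal.ofReal (R ^ β)) *
        μ (ball y R) ^ (-(1 / p)) * (∫⁻ z, f z ^ p ∂μ) ^ (1 / p) := by
  have hp0 : 0 < p := by linarith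
  have hpi : 0 < 1 / p := by positivity
  set N := (∫⁻ z, f z ^ p ∂μ) ^ (1 / p) with hN
  set B : ℕ → Set X := fun n => (ball y (2 ^ n * R))ᶜ ∩ ball y (2 ^ (n + 1) * R) with hB
  calc ∫⁻ z in (ball y R)ᶜ, f z * rieszKernel μ β y z ∂μ
      ≤ ∑' n : ℕ, ENNReal.ofReal ((2 ^ (n + 1) * R) ^ β) / μ (ball y (2 ^ n * R)) *
          ∫⁻ z in B n, f z ∂μ := by
        refine setLIntegral_mul_le_tsum hf measurableSet_ball.compl
          (fun n => measurableSet_ball.compl.inter measurableSet_ball) ?_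
        intro z hz
        rw [mem_compl_iff, mem_ball', not_lt] at hz
        obtain ⟨n, h1, h2⟩ := exists_two_pow_mul_le_lt hR hz
        refine Or.inr ⟨n, ⟨?_, mem_ball'.2 h2⟩, ?_⟩
        · rw [mem_compl_iff, mem_ball', not_lt]; exact h1
        · unfold rieszKernel
          gcongr
    _ ≤ ∑' n : ℕ, ENNReal.ofReal c * ENNReal.ofReal (cσ ^ (1 / p)) *
        (ENNReal.ofReal (2 ^ (β - σ / p)) * ENNReal.ofReal (R ^ β)) *
        μ (ball y R) ^ (-(1 / p)) * N * ENNReal.ofReal ((2 : ℝ) ^ (-(σ / p - β))) ^ n := by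
        refine ENNReal.tsum_le_tsum fun n => ?_
        -- Reverse doubling is available only up to radius `2 diam X`. Empty annuli contribute
        -- nothing, and a point of a nonempty one lies at distance at least `2^n R` from `y`, so
        -- `2^(n+1) R ≤ 2 diam X`.
        rcases (B n).eq_empty_or_nonempty with hBn | ⟨z, hz1, hz2⟩
        · simp [hBn]
        rw [mem_compl_iff, mem_ball', not_lt] at hz1
        set V := μ (ball y (2 ^ (n + 1) * R)) with hV
        have hVp := hb y (2 ^ (n + 1) * R) (by positivity)
        have hVn := hb y (2 ^ n * R) (by positivity)
        have hV0 := hb y R (by positivity)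
        rw [← hV] at hVp
        have hdiam : ENNReal.ofReal (2 ^ (n + 1) * R) ≤ 2 * ediam (univ : Set X) := by
          have h1 : ENNReal.ofReal (2 ^ n * R) ≤ ediam (univ : Set X) := by
            refine le_trans (ENNReal.ofReal_le_ofReal hz1) ?_
            rw [← edist_dist]
            exact edist_le_ediam_of_mem (mem_univ _) (mem_univ _)
          calc ENNReal.ofReal (2 ^ (n + 1) * R) = 2 * ENNReal.ofReal (2 ^ n * R) := by
                rw [pow_succ', mul_assoc, ENNReal.ofReal_mul (by norm_num), ENNReal.ofReal_ofNat]
            _ ≤ _ := by gcongr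
        have hR1 : R < 2 ^ (n + 1) * R := by
          have : (1 : ℝ) < 2 ^ (n + 1) := one_lt_pow₀ (by norm_num) (by simp)
          nlinarith
        have h1 := hrd y R (2 ^ (n + 1) * R) hR hR1 hdiam
        have hinv : V⁻¹ ≤ ENNReal.ofReal (cσ * (R / (2 ^ (n + 1) * R)) ^ σ) * (μ (ball y R))⁻¹ := by
          rw [← hV, div_eq_mul_inv, mul_comm] at h1
          have := (ENNReal.le_div_iff_mul_le (Or.inl hV0.1.ne') (Or.inl hV0.2.ne)).2 h1
          rwa [div_eq_mul_inv] at this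
        have hdbl : (μ (ball y (2 ^ n * R)))⁻¹ ≤ ENNReal.ofReal c * V⁻¹ := by
          have := hd y (2 ^ n * R) (by positivity)
          rw [← mul_assoc, ← pow_succ', ← hV] at this
          rw [← div_eq_mul_inv, ENNReal.le_div_iff_mul_le (Or.inl hVp.1.ne') (Or.inl hVp.2.ne),
            mul_comm, ← div_eq_mul_inv]
          exact ENNReal.div_le_of_le_mul this
        have hpow : V⁻¹ * V ^ (1 - 1 / p) = V⁻¹ ^ (1 / p) := by
          rw [← ENNReal.rpow_neg_one, ← ENNReal.rpow_mul, ← ENNReal.rpow_add _ _ hVp.1.ne' hVp.2.ne]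
          ring_nf
        calc ENNReal.ofReal ((2 ^ (n + 1) * R) ^ β) / μ (ball y (2 ^ n * R)) * ∫⁻ z in B n, f z ∂μ
            ≤ ENNReal.ofReal ((2 ^ (n + 1) * R) ^ β) * (ENNReal.ofReal c * V⁻¹) *
                (N * V ^ (1 - 1 / p)) := by
              rw [div_eq_mul_inv]
              gcongr
              refine (setLIntegral_le_rpow_mul hp hf (B n)).trans ?_
              gcongr
              · simpa using inv_le_one_of_one_le₀ hp.le
              · exact measure_mono inter_subset_right
          _ = ENNReal.ofReal c * N * (ENNReal.ofReal ((2 ^ (n + 1) * R) ^ β) * V⁻¹ ^ (1 / p)) := by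
              rw [← hpow]; ring
          _ ≤ ENNReal.ofReal c * N * (ENNReal.ofReal ((2 ^ (n + 1) * R) ^ β) *
              (ENNReal.ofReal (cσ * (R / (2 ^ (n + 1) * R)) ^ σ) * (μ (ball y R))⁻¹) ^
                (1 / p)) := by
              gcongr
          _ = _ := by
              rw [ENNReal.mul_rpow_of_nonneg _ _ hpi.le, ← ENNReal.rpow_neg_one (μ (ball y R)),
                ← ENNReal.rpow_mul, ENNReal.ofReal_rpow_of_nonneg (by positivity) hpi.le]
              -- Growth `2^(nβ)` of the kernel against decay `2^(-nσ/p)` from reverse doubling gives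
              -- the ratio `2^(-(σ/p - β))`.
              have hreal : (2 ^ (n + 1) * R) ^ β * (cσ * (R / (2 ^ (n + 1) * R)) ^ σ) ^ (1 / p) =
                  cσ ^ (1 / p) * (2 ^ (β - σ / p) * R ^ β) * (2 ^ (-(σ / p - β))) ^ n := by
                have e : R / (2 ^ (n + 1) * R) = 1 / 2 ^ (n + 1) := by field_simp
                rw [e, Real.mul_rpow hcσ.le (by positivity), ← Real.rpow_mul (by positivity),
                  two_pow_mul_rpow hR, div_two_pow_rpow one_pos, Real.one_rpow, one_mul,
                  mul_one_div, neg_sub]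
                have : ((2 : ℝ) ^ (β - σ / p)) ^ (n + 1) =
                    ((2 : ℝ) ^ β) ^ (n + 1) * ((2 : ℝ) ^ (-(σ / p))) ^ (n + 1) := by
                  rw [← mul_pow, ← Real.rpow_add (by norm_num), sub_eq_add_neg]
                have h3 : cσ ^ (1 / p) * (2 ^ (β - σ / p) * R ^ β) * (2 ^ (β - σ / p)) ^ n
                    = cσ ^ (1 / p) * R ^ β * (2 ^ (β - σ / p)) ^ (n + 1) := by ring
                rw [h3, this]; ring
              have hE := congrArg ENNReal.ofReal hreal
              rw [ENNReal.ofReal_mul (by positivity), ENNReal.ofReal_mul (by positivity),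
                ENNReal.ofReal_mul (by positivity), ENNReal.ofReal_mul (by positivity),
                ENNReal.ofReal_pow (by positivity)] at hE
              rw [← mul_assoc (ENNReal.ofReal ((2 ^ (n + 1) * R) ^ β)), hE, neg_one_mul]
              ring
    _ = _ := by rw [ENNReal.tsum_mul_left, geomSum]; ring

/-- One side of the real kernel estimate, transferred to `ℝ≥0∞`; positivity and finiteness of the
balls make the two quotients agree. -/
theorem KernelEstimate.rieszKernel_le (hb : BallsPosFinite μ) {β η cK : ℝ} (hcK : 0 < cK)
    (hk : KernelEstimate μ β η cK) {w y z : X} (hwy : w ≠ y) (hz : z ∉ ball w (2 * dist w y)) :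
    rieszKernel μ β w z ≤ rieszKernel μ β y z + ENNReal.ofReal cK * ENNReal.ofReal (dist w y ^ η) *
      (ENNReal.ofReal (dist w z ^ (-(η - β))) / μ (ball w (dist w z))) := by
  have h := (abs_le.1 (hk w y hwy z hz)).2
  rw [mem_ball', not_lt] at hz
  have hwy' := dist_pos.2 hwy
  have hwz : 0 < dist w z := by linarith
  have hyz : 0 < dist y z := by linarith [dist_triangle w y z]
  have key : ∀ v : X, 0 < dist v z → ∀ a : ℝ,
      ENNReal.ofReal a / μ (ball v (dist v z)) =
        ENNReal.ofReal (a / μ.real (ball v (dist v z))) := by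
    intro v hv a
    have h1 := hb v _ hv
    rw [Measure.real, ENNReal.ofReal_div_of_pos (ENNReal.toReal_pos h1.1.ne' h1.2.ne),
      ENNReal.ofReal_toReal h1.2.ne]
  unfold rieszKernel
  rw [key w hwz, key w hwz, key y hyz, mul_assoc, ← ENNReal.ofReal_mul (by positivity),
    ← ENNReal.ofReal_mul hcK.le, ← ENNReal.ofReal_add (by positivity) (by positivity)]
  refine ENNReal.ofReal_le_ofReal ?_
  have e : dist w y ^ η / (dist w z ^ (η - β) * μ.real (ball w (dist w z))) =
      dist w y ^ η * (dist w z ^ (-(η - β)) / μ.real (ball w (dist w z))) := by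
    rw [Real.rpow_neg hwz.le]; field_simp
  rw [e] at h
  linarith

/-- The Riesz potential of `f` has a Hajłasz gradient comparable to the maximal function. -/
theorem IsDoublingWith.rieszPotential_le_add [OpensMeasurableSpace X]
    (hb : BallsPosFinite μ) (hd : IsDoublingWith μ c) {β η cK : ℝ} (hβ : 0 < β) (hη : β < η)
    (hcK : 0 < cK) (hk : KernelEstimate μ β η cK) {f : X → ℝ≥0∞} (hf : Measurable f) (w y : X) :
    rieszPotential μ β f w ≤ rieszPotential μ β f y +
      ENNReal.ofReal c * (geomSum β * ENNReal.ofReal (2 ^ β) +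
        ENNReal.ofReal cK * geomSum (η - β)) *
        ENNReal.ofReal (dist w y ^ β) * maximalFunction μ f w := by
  rcases eq_or_ne w y with rfl | hwy
  · exact le_self_add
  have hwy' := dist_pos.2 hwy
  have hR : 0 < 2 * dist w y := by positivity
  have hθ : 0 < η - β := by linarith
  -- Split at radius `2 d(w,y)`: inside, the potential at `w` is small by Hedberg's estimate;
  -- outside, the kernel estimate allows the pole to move from `w` to `y`.
  rw [rieszPotential_eq, rieszPotential_eq,
    ← lintegral_add_compl (fun z => f z * rieszKernel μ β w z)
      (measurableSet_ball (x := w) (ε := 2 * dist w y))]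
  have h1 := hd.setLIntegral_ball_mul_rieszKernel_le hb hβ hf w hR
  have h2 : ∫⁻ z in (ball w (2 * dist w y))ᶜ, f z * rieszKernel μ β w z ∂μ ≤
      ∫⁻ z, f z * rieszKernel μ β y z ∂μ +
        ENNReal.ofReal cK * ENNReal.ofReal (dist w y ^ η) * (ENNReal.ofReal c * geomSum (η - β) *
          ENNReal.ofReal ((2 * dist w y) ^ (-(η - β))) * maximalFunction μ f w) := by
    calc ∫⁻ z in (ball w (2 * dist w y))ᶜ, f z * rieszKernel μ β w z ∂μ
        ≤ ∫⁻ z in (ball w (2 * dist w y))ᶜ, (f z * rieszKernel μ β y z +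
            ENNReal.ofReal cK * ENNReal.ofReal (dist w y ^ η) * (f z *
            (ENNReal.ofReal (dist w z ^ (-(η - β))) / μ (ball w (dist w z))))) ∂μ := by
          refine setLIntegral_mono' measurableSet_ball.compl fun z hz => ?_
          calc f z * rieszKernel μ β w z ≤ f z * (rieszKernel μ β y z +
                ENNReal.ofReal cK * ENNReal.ofReal (dist w y ^ η) *
                (ENNReal.ofReal (dist w z ^ (-(η - β))) / μ (ball w (dist w z)))) := by
                gcongr; exact hk.rieszKernel_le hb hcK hwy hz
            _ = _ := by ring
      _ ≤ _ := by
          rw [lintegral_add_left (measurable_mul_rieszKernel β hf y),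
            lintegral_const_mul' _ _ (by finiteness)]
          gcongr
          · exact Measure.restrict_le_self
          · exact hd.setLIntegral_compl_ball_mul_le hb hθ hf w hR
  have h3 : ENNReal.ofReal (dist w y ^ η) * ENNReal.ofReal ((2 * dist w y) ^ (-(η - β))) ≤
      ENNReal.ofReal (dist w y ^ β) := by
    rw [← ENNReal.ofReal_mul (by positivity)]
    refine ENNReal.ofReal_le_ofReal ?_
    calc dist w y ^ η * (2 * dist w y) ^ (-(η - β))
        ≤ dist w y ^ η * (dist w y) ^ (-(η - β)) := by
          gcongr ?_ * ?_
          exact Real.rpow_le_rpow_of_nonpos hwy' (by linarith) (by linarith)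
      _ = dist w y ^ β := by rw [← Real.rpow_add hwy']; ring_nf
  set M := maximalFunction μ f w
  set I := ∫⁻ z, f z * rieszKernel μ β y z ∂μ
  calc _ ≤ ENNReal.ofReal c * geomSum β * ENNReal.ofReal ((2 * dist w y) ^ β) * M +
      (I + ENNReal.ofReal cK * ENNReal.ofReal (dist w y ^ η) * (ENNReal.ofReal c * geomSum (η - β) *
          ENNReal.ofReal ((2 * dist w y) ^ (-(η - β))) * M)) := add_le_add h1 h2
    _ = ENNReal.ofReal c * geomSum β * ENNReal.ofReal ((2 * dist w y) ^ β) * M +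
      (I + ENNReal.ofReal cK * (ENNReal.ofReal (dist w y ^ η) *
        ENNReal.ofReal ((2 * dist w y) ^ (-(η - β)))) *
          (ENNReal.ofReal c * geomSum (η - β) * M)) := by
        ring
    _ ≤ ENNReal.ofReal c * geomSum β * ENNReal.ofReal ((2 * dist w y) ^ β) * M +
      (I + ENNReal.ofReal cK * ENNReal.ofReal (dist w y ^ β) *
        (ENNReal.ofReal c * geomSum (η - β) * M)) := by gcongr
    _ = _ := by
        rw [Real.mul_rpow (by norm_num) hwy'.le, ENNReal.ofReal_mul (by positivity)]
        ring

end Annuli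

/-! ### The Riesz capacity is bounded by the Hajłasz capacity. -/

section LowerBound

theorem ofReal_abs_sub_le (a b t : ℝ) :
    ENNReal.ofReal |a - t| ≤ ENNReal.ofReal |b - t| + ENNReal.ofReal |a - b| := by
  rw [← ENNReal.ofReal_add (abs_nonneg _) (abs_nonneg _)]
  refine ENNReal.ofReal_le_ofReal ?_
  have := abs_sub_le a b t
  linarith

/-- Average `|u(v) - t| ≤ |u(w) - t| + D^β (g(v) + g(w))` over `w ∈ B`, then over `v ∈ A`. In the
applications `t` is the value of `u` at the common centre of the telescoping balls. -/
theorem IsHajlaszGradient.mean_le_add {β : ℝ} (hβ : 0 < β) {u : X → ℝ} {g : X → ℝ≥0∞}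
    (hu : Measurable u) (hg : IsHajlaszGradient μ β u g) {A B : Set X} (hA : MeasurableSet A)
    (hB : MeasurableSet B) (hA0 : 0 < μ A) (hAt : μ A < ∞) (hB0 : 0 < μ B) (hBt : μ B < ∞)
    {D : ℝ} (hD : ∀ v ∈ A, ∀ w ∈ B, dist v w ≤ D) (t : ℝ) :
    (∫⁻ v in A, ENNReal.ofReal |u v - t| ∂μ) / μ A ≤
      (∫⁻ w in B, ENNReal.ofReal |u w - t| ∂μ) / μ B +
        ENNReal.ofReal (D ^ β) * ((∫⁻ v in A, g v ∂μ) / μ A + (∫⁻ w in B, g w ∂μ) / μ B) := by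
  obtain ⟨hgm, N, hN, hgN⟩ := hg
  have hN' : ∀ᵐ v ∂μ, v ∉ N := measure_eq_zero_iff_ae_notMem.1 hN
  have hum : Measurable fun v => ENNReal.ofReal |u v - t| :=
    (hu.sub_const t).abs.ennreal_ofReal
  set S := (∫⁻ w in B, ENNReal.ofReal |u w - t| ∂μ) / μ B
  set G := (∫⁻ w in B, g w ∂μ) / μ B
  have hcA : ∀ a : ℝ≥0∞, a * μ A / μ A = a := fun a =>
    ENNReal.mul_div_cancel_right hA0.ne' hAt.ne
  have hcB : ∀ a : ℝ≥0∞, a * μ B / μ B = a := fun a =>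
    ENNReal.mul_div_cancel_right hB0.ne' hBt.ne
  have hpt : ∀ v ∈ A, v ∉ N →
      ENNReal.ofReal |u v - t| ≤ S + ENNReal.ofReal (D ^ β) * (g v + G) := by
    intro v hv hvN
    calc ENNReal.ofReal |u v - t| = (∫⁻ _ in B, ENNReal.ofReal |u v - t| ∂μ) / μ B := by
          rw [setLIntegral_const, hcB]
      _ ≤ (∫⁻ w in B, (ENNReal.ofReal |u w - t| +
            ENNReal.ofReal (D ^ β) * (g v + g w)) ∂μ) / μ B := by
          gcongr ?_ / _
          refine lintegral_mono_ae ?_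
          filter_upwards [ae_restrict_of_ae hN', ae_restrict_mem hB] with w hwN hw
          refine (ofReal_abs_sub_le _ (u w) t).trans ?_
          gcongr
          refine (hgN v hvN w hwN).trans ?_
          gcongr
          exact hD v hv w hw
      _ = _ := by
          rw [lintegral_add_left hum, lintegral_const_mul _ (hgm.const_add _),
            lintegral_add_left measurable_const, setLIntegral_const, ENNReal.add_div,
            mul_div_assoc, ENNReal.add_div, hcB]
  calc (∫⁻ v in A, ENNReal.ofReal |u v - t| ∂μ) / μ A
      ≤ (∫⁻ v in A, (S + ENNReal.ofReal (D ^ β) * (g v + G)) ∂μ) / μ A := by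
        gcongr ?_ / _
        refine lintegral_mono_ae ?_
        filter_upwards [ae_restrict_of_ae hN', ae_restrict_mem hA] with v hvN hv
        exact hpt v hv hvN
    _ = _ := by
        rw [lintegral_add_left measurable_const, lintegral_const_mul _ (hgm.add_const _),
          lintegral_add_left hgm, setLIntegral_const, setLIntegral_const, ENNReal.add_div,
          hcA, mul_div_assoc, ENNReal.add_div, hcA]

theorem LipBeta.continuous {Y : Type*} [MetricSpace Y] {β : ℝ} (hβ : 0 < β) {u : Y → ℝ}
    (hu : u ∈ LipBeta Y β) :
    Continuous u := by
  obtain ⟨κ, hκ, h⟩ := hu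
  rw [continuous_iff_continuousAt]
  intro x
  rw [ContinuousAt, tendsto_iff_dist_tendsto_zero]
  have hc : Continuous fun y : Y => κ * dist y x ^ β :=
    continuous_const.mul ((continuous_id.dist continuous_const).rpow_const fun _ => Or.inr hβ.le)
  have h0 := hc.tendsto x
  simp only [dist_self, Real.zero_rpow hβ.ne', mul_zero] at h0
  exact squeeze_zero (fun _ => dist_nonneg) (fun y => h y x) h0

theorem IsDoublingWith.div_measure_le (hd : IsDoublingWith μ c) {A : Set X} {x y : X} {s r : ℝ}
    (hr : 0 < r) (n : ℕ) (h : s + dist x y ≤ 2 ^ n * r) (hA : A ⊆ ball x s) (hsp : 0 < μ (ball x s))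
    (hst : μ (ball x s) < ∞) (g : X → ℝ≥0∞) :
    (∫⁻ z in A, g z ∂μ) / μ (ball y r) ≤
      ENNReal.ofReal c ^ n * ((∫⁻ z in ball x s, g z ∂μ) / μ (ball x s)) := by
  refine ENNReal.div_le_of_le_mul ?_
  calc ∫⁻ z in A, g z ∂μ ≤ ∫⁻ z in ball x s, g z ∂μ := lintegral_mono_set hA
    _ = (∫⁻ z in ball x s, g z ∂μ) / μ (ball x s) * μ (ball x s) :=
        (ENNReal.div_mul_cancel hsp.ne' hst.ne).symm
    _ ≤ (∫⁻ z in ball x s, g z ∂μ) / μ (ball x s) * (ENNReal.ofReal c ^ n * μ (ball y r)) := by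
        gcongr; exact hd.measure_ball_le hr n h
    _ = _ := by ring

theorem tendsto_ofReal_mul_pow_zero (a : ℝ) {θ : ℝ} (hθ : 0 < θ) :
    Filter.Tendsto (fun n : ℕ => ENNReal.ofReal (a * ((2 : ℝ) ^ (-θ)) ^ n)) Filter.atTop
      (nhds 0) := by
  have hq : (2 : ℝ) ^ (-θ) < 1 := Real.rpow_lt_one_of_one_lt_of_neg one_lt_two (by linarith)
  have := (tendsto_pow_atTop_nhds_zero_of_lt_one (by positivity) hq).const_mul a
  simpa using ENNReal.tendsto_ofReal this

/-- The telescoping estimate along the balls `B (y, R / 2 ^ k)`. -/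
theorem IsDoublingWith.mean_sub_le_tsum [OpensMeasurableSpace X] (hb : BallsPosFinite μ)
    (hd : IsDoublingWith μ c) {β : ℝ} (hβ : 0 < β) {u : X → ℝ} {g : X → ℝ≥0∞}
    (hu : u ∈ LipBeta X β) (hg : IsHajlaszGradient μ β u g) (y : X) {R : ℝ} (hR : 0 < R) :
    (∫⁻ v in ball y R, ENNReal.ofReal |u v - u y| ∂μ) / μ (ball y R) ≤
      ENNReal.ofReal (2 ^ β) * (1 + ENNReal.ofReal c) *
        ∑' k : ℕ, ENNReal.ofReal ((R / 2 ^ k) ^ β) *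
          ((∫⁻ z in ball y (R / 2 ^ k), g z ∂μ) / μ (ball y (R / 2 ^ k))) := by
  have hum : Measurable u := (LipBeta.continuous hβ hu).measurable
  set ρ : ℕ → ℝ := fun k => R / 2 ^ k with hρ
  have hρ0 : ∀ k, 0 < ρ k := fun k => by positivity
  set a : ℕ → ℝ≥0∞ := fun k =>
    (∫⁻ v in ball y (ρ k), ENNReal.ofReal |u v - u y| ∂μ) / μ (ball y (ρ k)) with ha
  set m : ℕ → ℝ≥0∞ := fun k => (∫⁻ z in ball y (ρ k), g z ∂μ) / μ (ball y (ρ k)) with hm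
  set K := ENNReal.ofReal (2 ^ β) * (1 + ENNReal.ofReal c) with hK
  have hstep : ∀ k, a k ≤ a (k + 1) + K * (ENNReal.ofReal (ρ k ^ β) * m k) := by
    intro k
    have hρk : ρ (k + 1) ≤ ρ k := by
      simp only [hρ]
      gcongr
      · norm_num
      · simp
    have hk := hb y _ (hρ0 k)
    have hk1 := hb y _ (hρ0 (k + 1))
    have h1 := hg.mean_le_add hβ hum (A := ball y (ρ k)) (B := ball y (ρ (k + 1)))
      measurableSet_ball measurableSet_ball hk.1 hk.2 hk1.1 hk1.2 (D := 2 * ρ k)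
      (fun v hv w hw => by
        have h1 := mem_ball.1 hv
        have h2 := mem_ball'.1 hw
        linarith [dist_triangle v y w]) (u y)
    have h2 : m (k + 1) ≤ ENNReal.ofReal c * m k := by
      have := hd.div_measure_le (A := ball y (ρ (k + 1))) (x := y) (y := y) (s := ρ k)
        (hρ0 (k + 1)) 1 (by simp only [hρ, dist_self, pow_succ]; field_simp; norm_num)
        (ball_subset_ball hρk) hk.1 hk.2 g
      simpa using this
    calc a k ≤ a (k + 1) + ENNReal.ofReal ((2 * ρ k) ^ β) * (m k + m (k + 1)) := h1
      _ ≤ a (k + 1) + ENNReal.ofReal ((2 * ρ k) ^ β) * (m k + ENNReal.ofReal c * m k) := by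
          gcongr
      _ = _ := by
          rw [Real.mul_rpow (by norm_num) (hρ0 k).le, ENNReal.ofReal_mul (by positivity)]
          ring
  have hsum : ∀ n, a 0 ≤ a n + K * ∑ k ∈ Finset.range n, ENNReal.ofReal (ρ k ^ β) * m k := by
    intro n
    induction n with
    | zero => simp
    | succ n ih =>
      refine ih.trans ?_
      rw [Finset.sum_range_succ, mul_add]
      calc _ ≤ a (n + 1) + K * (ENNReal.ofReal (ρ n ^ β) * m n) +
            K * ∑ k ∈ Finset.range n, ENNReal.ofReal (ρ k ^ β) * m k := by gcongr; exact hstep n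
        _ = _ := by ring
  obtain ⟨κ, hκ, hκu⟩ := hu
  -- Hölder continuity sends the remainder to zero at every `y`, so no exceptional null set of
  -- non-Lebesgue points appears.
  have han : ∀ n, a n ≤ ENNReal.ofReal (κ * R ^ β * ((2 : ℝ) ^ (-β)) ^ n) := by
    intro n
    refine ENNReal.div_le_of_le_mul ?_
    rw [← setLIntegral_const]
    refine setLIntegral_mono' measurableSet_ball fun v hv => ENNReal.ofReal_le_ofReal ?_
    refine (hκu v y).trans ?_
    rw [mul_assoc, ← div_two_pow_rpow hR]
    gcongr
    exact (mem_ball.1 hv).le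
  have hlim := (tendsto_ofReal_mul_pow_zero (κ * R ^ β) hβ).add_const
    (K * ∑' k : ℕ, ENNReal.ofReal (ρ k ^ β) * m k)
  rw [zero_add] at hlim
  have h0 : a 0 ≤ K * ∑' k : ℕ, ENNReal.ofReal (ρ k ^ β) * m k :=
    ge_of_tendsto' hlim fun n => (hsum n).trans
      (add_le_add (han n) (by gcongr; exact ENNReal.sum_le_tsum _))
  simpa [ha, hρ] using h0

theorem IsReverseDoublingWith.inv_measure_le (hb : BallsPosFinite μ) {cσ σ : ℝ}
    (hrd : IsReverseDoublingWith μ cσ σ) (y : X) {r R : ℝ} (hr : 0 < r) (hrR : r < R)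
    (hR : ENNReal.ofReal R ≤ 2 * ediam (univ : Set X)) :
    (μ (ball y R))⁻¹ ≤ ENNReal.ofReal (cσ * (r / R) ^ σ) * (μ (ball y r))⁻¹ := by
  have h := hrd y r R hr hrR hR
  have h0 := hb y r hr
  rw [div_eq_mul_inv, mul_comm] at h
  rw [← div_eq_mul_inv]
  exact (ENNReal.le_div_iff_mul_le (Or.inl h0.1.ne') (Or.inl h0.2.ne)).2 h

/-- Needed because the kernel is `0` at its pole, so the potential would miss an atom that the means
of `g` do count. -/
theorem IsReverseDoublingWith.measure_singleton (hb : BallsPosFinite μ) {cσ σ : ℝ}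
    (hrd : IsReverseDoublingWith μ cσ σ) (hσ : 0 < σ) (y : X) {R : ℝ} (hR0 : 0 < R)
    (hR : ENNReal.ofReal R ≤ 2 * ediam (univ : Set X)) : μ {y} = 0 := by
  have hB := hb y R hR0
  have h1 : ∀ n : ℕ, μ {y} ≤ ENNReal.ofReal (cσ * ((2 : ℝ) ^ (-σ)) ^ (n + 1)) * μ (ball y R) := by
    intro n
    have hlt : R / 2 ^ (n + 1) < R :=
      div_lt_self hR0 (one_lt_pow₀ (by norm_num) (by simp))
    have h := hrd y (R / 2 ^ (n + 1)) R (by positivity) hlt hR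
    rw [ENNReal.div_le_iff hB.1.ne' hB.2.ne] at h
    have e : (R / 2 ^ (n + 1) / R) ^ σ = ((2 : ℝ) ^ (-σ)) ^ (n + 1) := by
      rw [show R / 2 ^ (n + 1) / R = 1 / 2 ^ (n + 1) by field_simp, div_two_pow_rpow one_pos]
      simp
    rw [e] at h
    exact (measure_mono (singleton_subset_iff.2 (mem_ball_self (by positivity)))).trans h
  have h2 := ENNReal.Tendsto.mul_const (b := μ (ball y R))
    ((tendsto_ofReal_mul_pow_zero cσ hσ).comp (Filter.tendsto_add_atTop_nat 1)) (Or.inr hB.2.ne)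
  rw [zero_mul] at h2
  exact le_antisymm (ge_of_tendsto' h2 h1) (zero_le)

theorem sum_range_pow_sub_le_tsum (q : ℝ≥0∞) (m : ℕ) :
    ∑ k ∈ Finset.range (m + 1), q ^ (m - k) ≤ ∑' k : ℕ, q ^ k := by
  have := Finset.sum_range_reflect (fun k => q ^ k) (m + 1)
  simp only [Nat.add_sub_cancel] at this
  rw [this]
  exact ENNReal.sum_le_tsum _

/-- Only balls of radius larger than `d(y,z)` contribute. Reverse doubling, applied from `d(y,z)` up
to `R/2^k`, makes the terms decay geometrically as the radius grows because `β < σ`, so the smallest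
such ball, comparable to `B(y,d(y,z))`, dominates. -/
theorem IsReverseDoublingWith.tsum_indicator_le (hb : BallsPosFinite μ) {cσ σ β : ℝ}
    (hrd : IsReverseDoublingWith μ cσ σ) (hcσ : 0 < cσ) (hσ : β < σ) {y z : X} (hyz : y ≠ z)
    {R : ℝ} (hR0 : 0 < R) (hR : ENNReal.ofReal R ≤ 2 * ediam (univ : Set X)) :
    ∑' k : ℕ, (ball y (R / 2 ^ k)).indicator
      (fun _ => ENNReal.ofReal ((R / 2 ^ k) ^ β) / μ (ball y (R / 2 ^ k))) z ≤
      ENNReal.ofReal cσ * geomSum (σ - β) * rieszKernel μ β y z := by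
  have hdp := dist_pos.2 hyz
  rcases lt_or_ge (dist y z) R with hlt | hge
  swap
  · have : ∀ k : ℕ, z ∉ ball y (R / 2 ^ k) := fun k hk => by
      have h1 := mem_ball'.1 hk
      have h2 : R / 2 ^ k ≤ R := div_le_self hR0.le (one_le_pow₀ (by norm_num))
      linarith
    simp [this]
  obtain ⟨m, hm1, hm2⟩ := exists_div_two_pow_le_lt hdp hlt
  have hout : ∀ k ∉ Finset.range (m + 1), (ball y (R / 2 ^ k)).indicator
      (fun _ => ENNReal.ofReal ((R / 2 ^ k) ^ β) / μ (ball y (R / 2 ^ k))) z = 0 := by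
    intro k hk
    refine indicator_of_notMem (fun h => ?_) _
    rw [Finset.mem_range, not_lt] at hk
    have h1 := mem_ball'.1 h
    have h2 : R / 2 ^ k ≤ R / 2 ^ (m + 1) := by gcongr; norm_num
    linarith
  rw [tsum_eq_sum hout]
  calc ∑ k ∈ Finset.range (m + 1), (ball y (R / 2 ^ k)).indicator
        (fun _ => ENNReal.ofReal ((R / 2 ^ k) ^ β) / μ (ball y (R / 2 ^ k))) z
      ≤ ∑ k ∈ Finset.range (m + 1), ENNReal.ofReal cσ * rieszKernel μ β y z *
          ENNReal.ofReal ((2 : ℝ) ^ (-(σ - β))) ^ (m - k) := by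
        refine Finset.sum_le_sum fun k hk => ?_
        rw [Finset.mem_range] at hk
        have hkm : R / 2 ^ m ≤ R / 2 ^ k := by
          gcongr
          · norm_num
          · omega
        have hρ : 0 < R / 2 ^ k := by positivity
        have hdk : dist y z < R / 2 ^ k := hm2.trans_le hkm
        rw [indicator_of_mem (mem_ball'.2 hdk), div_eq_mul_inv]
        have hρR : ENNReal.ofReal (R / 2 ^ k) ≤ 2 * ediam (univ : Set X) :=
          (ENNReal.ofReal_le_ofReal (div_le_self hR0.le (one_le_pow₀ (by norm_num)))).trans hR
        have h1 := hrd.inv_measure_le hb y hdp hdk hρR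
        have hreal : (R / 2 ^ k) ^ β * (cσ * (dist y z / (R / 2 ^ k)) ^ σ) ≤
            cσ * dist y z ^ β * ((2 : ℝ) ^ (-(σ - β))) ^ (m - k) := by
          have e1 : (dist y z / (R / 2 ^ k)) ^ σ =
              (dist y z / (R / 2 ^ k)) ^ β * (dist y z / (R / 2 ^ k)) ^ (σ - β) := by
            rw [← Real.rpow_add (by positivity)]; ring_nf
          have e2 : (R / 2 ^ k) ^ β * (dist y z / (R / 2 ^ k)) ^ β = dist y z ^ β := by
            rw [← Real.mul_rpow hρ.le (by positivity)]; congr 1; field_simp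
          have e3 : (dist y z / (R / 2 ^ k)) ^ (σ - β) ≤ ((2 : ℝ) ^ (-(σ - β))) ^ (m - k) := by
            have : ((2 : ℝ) ^ (-(σ - β))) ^ (m - k) = (1 / 2 ^ (m - k)) ^ (σ - β) := by
              rw [div_two_pow_rpow one_pos]; simp
            rw [this]
            refine Real.rpow_le_rpow (by positivity) ?_ (by linarith)
            rw [div_le_iff₀ hρ]
            refine hm2.le.trans (le_of_eq ?_)
            have : (2 : ℝ) ^ m = 2 ^ (m - k) * 2 ^ k := by
              rw [← pow_add]; congr 1; omega
            rw [this]; field_simp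
          calc _ = cσ * ((R / 2 ^ k) ^ β * (dist y z / (R / 2 ^ k)) ^ β) *
                (dist y z / (R / 2 ^ k)) ^ (σ - β) := by rw [e1]; ring
            _ ≤ _ := by rw [e2]; gcongr
        calc ENNReal.ofReal ((R / 2 ^ k) ^ β) * (μ (ball y (R / 2 ^ k)))⁻¹
            ≤ ENNReal.ofReal ((R / 2 ^ k) ^ β) *
              (ENNReal.ofReal (cσ * (dist y z / (R / 2 ^ k)) ^ σ) * (μ (ball y (dist y z)))⁻¹) := by
              gcongr
          _ = ENNReal.ofReal ((R / 2 ^ k) ^ β * (cσ * (dist y z / (R / 2 ^ k)) ^ σ)) *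
              (μ (ball y (dist y z)))⁻¹ := by
              rw [← mul_assoc, ← ENNReal.ofReal_mul (by positivity)]
          _ ≤ ENNReal.ofReal (cσ * dist y z ^ β * ((2 : ℝ) ^ (-(σ - β))) ^ (m - k)) *
              (μ (ball y (dist y z)))⁻¹ := by gcongr
          _ = _ := by
              rw [ENNReal.ofReal_mul (by positivity), ENNReal.ofReal_mul (by positivity),
                ENNReal.ofReal_pow (by positivity), rieszKernel, div_eq_mul_inv]
              ring
    _ ≤ _ := by
        rw [← Finset.mul_sum, geomSum, mul_right_comm]
        gcongr
        exact sum_range_pow_sub_le_tsum _ m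

theorem IsReverseDoublingWith.tsum_mean_le_rieszPotential [OpensMeasurableSpace X]
    (hb : BallsPosFinite μ) {cσ σ β : ℝ} (hrd : IsReverseDoublingWith μ cσ σ) (hcσ : 0 < cσ)
    (hβ : 0 < β) (hσ : β < σ) {g : X → ℝ≥0∞} (hg : Measurable g) (y : X) {R : ℝ} (hR0 : 0 < R)
    (hR : ENNReal.ofReal R ≤ 2 * ediam (univ : Set X)) :
    ∑' k : ℕ, ENNReal.ofReal ((R / 2 ^ k) ^ β) *
        ((∫⁻ z in ball y (R / 2 ^ k), g z ∂μ) / μ (ball y (R / 2 ^ k))) ≤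
      ENNReal.ofReal cσ * geomSum (σ - β) * rieszPotential μ β g y := by
  have hy : ∀ᵐ z ∂μ, z ∉ ({y} : Set X) := measure_eq_zero_iff_ae_notMem.1
    (hrd.measure_singleton hb (hβ.trans hσ) y hR0 hR)
  calc ∑' k : ℕ, ENNReal.ofReal ((R / 2 ^ k) ^ β) *
        ((∫⁻ z in ball y (R / 2 ^ k), g z ∂μ) / μ (ball y (R / 2 ^ k)))
      = ∫⁻ z, ∑' k : ℕ, (ball y (R / 2 ^ k)).indicator
        (fun z => ENNReal.ofReal ((R / 2 ^ k) ^ β) / μ (ball y (R / 2 ^ k)) * g z) z ∂μ := by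
        rw [lintegral_tsum fun k =>
          ((hg.const_mul _).indicator measurableSet_ball).aemeasurable]
        refine tsum_congr fun k => ?_
        rw [lintegral_indicator measurableSet_ball, lintegral_const_mul _ hg]
        simp only [div_eq_mul_inv]; ring
    _ ≤ ∫⁻ z, ENNReal.ofReal cσ * geomSum (σ - β) * (g z * rieszKernel μ β y z) ∂μ := by
        refine lintegral_mono_ae ?_
        filter_upwards [hy] with z hz
        have hyz : y ≠ z := fun h => hz h.symm
        calc _ = (∑' k : ℕ, (ball y (R / 2 ^ k)).indicator (fun _ =>
              ENNReal.ofReal ((R / 2 ^ k) ^ β) / μ (ball y (R / 2 ^ k))) z) * g z := by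
              rw [← ENNReal.tsum_mul_right]
              refine tsum_congr fun k => ?_
              by_cases h : z ∈ ball y (R / 2 ^ k) <;> simp [h]
          _ ≤ ENNReal.ofReal cσ * geomSum (σ - β) * rieszKernel μ β y z * g z := by
              gcongr; exact hrd.tsum_indicator_le hb hcσ hσ hyz hR0 hR
          _ = _ := by ring
    _ = _ := by
        rw [rieszPotential_eq, lintegral_const_mul _ (measurable_mul_rieszKernel β hg y)]

/-- If all points were within `3r` of `x`, the diameter would be at most `6r`; the intermediate
value property on a connected space does the rest. The ball `B(z,r)` is disjoint from `B(x,2r)`, so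
test functions vanish on it. -/
theorem exists_dist_eq_three_mul {Y : Type*} [MetricSpace Y] [ConnectedSpace Y] (x : Y) {r : ℝ}
    (hr : 0 < r) (h : ENNReal.ofReal r < ediam (univ : Set Y) / 8) : ∃ z : Y, dist x z = 3 * r := by
  have h4 : ∃ z, 3 * r ≤ dist x z := by
    by_contra! hcon
    have : ediam (univ : Set Y) ≤ ENNReal.ofReal (8 * r) := by
      refine ediam_le fun a _ b _ => ?_
      rw [edist_dist]
      refine ENNReal.ofReal_le_ofReal ?_
      have h1 := hcon a
      have h2 := hcon b
      have h3 := dist_triangle a x b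
      rw [dist_comm a x] at h3
      linarith
    have h2 : ediam (univ : Set Y) / 8 ≤ ENNReal.ofReal r := by
      refine ENNReal.div_le_of_le_mul' ?_
      rwa [ENNReal.ofReal_mul (by norm_num), ENNReal.ofReal_ofNat] at this
    exact absurd h (not_lt.2 h2)
  exact mem_range_of_exists_le_of_exists_ge (f := fun z => dist x z)
    (continuous_const.dist continuous_id) ⟨x, by simp [hr.le]⟩ h4

/-- The constant in the pointwise bound of a function by the Riesz potential of a gradient. -/
noncomputable def pointwiseConst (c cσ σ β : ℝ) : ℝ≥0∞ :=
  ENNReal.ofReal (2 ^ β) * (2 + ENNReal.ofReal c + ENNReal.ofReal c ^ 4) *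
    (ENNReal.ofReal cσ * geomSum (σ - β))

/-- Since `u = 0` on `B(z,r)`, the mean of `|u - u(y)|` there is exactly `|u(y)|`; moving to
`B(y,8r)` and telescoping yields the potential of `g`. -/
theorem ofReal_abs_le_rieszPotential [OpensMeasurableSpace X] [ConnectedSpace X]
    (hb : BallsPosFinite μ) (hd : IsDoublingWith μ c) {cσ σ β : ℝ}
    (hrd : IsReverseDoublingWith μ cσ σ) (hcσ : 0 < cσ) (hβ : 0 < β) (hσ : β < σ)
    {x y : X} {r : ℝ} (hr : 0 < r) (hdiam : ENNReal.ofReal r < ediam (univ : Set X) / 8)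
    (hxy : dist x y ≤ r) {u : X → ℝ} {g : X → ℝ≥0∞} (hu : u ∈ LipBeta X β)
    (hu0 : ∀ v ∉ ball x (2 * r), u v = 0) (hg : IsHajlaszGradient μ β u g) :
    ENNReal.ofReal |u y| ≤ pointwiseConst c cσ σ β * rieszPotential μ β g y := by
  obtain ⟨z, hz⟩ := exists_dist_eq_three_mul x hr hdiam
  have hum : Measurable u := (LipBeta.continuous hβ hu).measurable
  -- Radius `8r` is large enough that `B(y,8r)` contains `B(z,r)`, and below `diam X`, so reverse
  -- doubling applies.
  have hR0 : 0 < 8 * r := by positivity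
  have hR : ENNReal.ofReal (8 * r) ≤ 2 * ediam (univ : Set X) := by
    rw [ENNReal.ofReal_mul (by norm_num), ENNReal.ofReal_ofNat]
    calc 8 * ENNReal.ofReal r ≤ 8 * (ediam (univ : Set X) / 8) := by gcongr
      _ = 1 * ediam (univ : Set X) := by
        rw [one_mul]; exact ENNReal.mul_div_cancel (by norm_num) (by norm_num)
      _ ≤ _ := by gcongr; norm_num
  have hzy : dist y z ≤ 4 * r := by
    have := dist_triangle y x z
    rw [dist_comm y x] at this
    linarith
  have hA := hb z r hr
  have hB := hb y (8 * r) hR0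
  have hsub : ball z r ⊆ ball y (8 * r) := ball_subset_ball' (by rw [dist_comm z y]; linarith)
  set T := ∑' k : ℕ, ENNReal.ofReal ((8 * r / 2 ^ k) ^ β) *
    ((∫⁻ z in ball y (8 * r / 2 ^ k), g z ∂μ) / μ (ball y (8 * r / 2 ^ k))) with hT
  set m := (∫⁻ z in ball y (8 * r), g z ∂μ) / μ (ball y (8 * r)) with hm
  have hmT : ENNReal.ofReal ((8 * r) ^ β) * m ≤ T := by
    have := ENNReal.le_tsum (f := fun k : ℕ => ENNReal.ofReal ((8 * r / 2 ^ k) ^ β) *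
      ((∫⁻ z in ball y (8 * r / 2 ^ k), g z ∂μ) / μ (ball y (8 * r / 2 ^ k)))) 0
    rw [hT]
    simpa using this
  have h1 := hg.mean_le_add hβ hum (A := ball z r) (B := ball y (8 * r)) measurableSet_ball
    measurableSet_ball hA.1 hA.2 hB.1 hB.2 (D := 2 * (8 * r)) (fun v hv w hw => by
      have h1 := mem_ball.1 (hsub hv)
      have h2 := mem_ball'.1 hw
      linarith [dist_triangle v y w]) (u y)
  have h2 : (∫⁻ v in ball z r, ENNReal.ofReal |u v - u y| ∂μ) / μ (ball z r) =
      ENNReal.ofReal |u y| := by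
    have : ∫⁻ v in ball z r, ENNReal.ofReal |u v - u y| ∂μ =
        ∫⁻ v in ball z r, ENNReal.ofReal |u y| ∂μ := by
      refine setLIntegral_congr_fun measurableSet_ball fun v hv => ?_
      have : u v = 0 := hu0 v fun hvx => by
        have h1 := mem_ball.1 hv
        have h2 := mem_ball'.1 hvx
        linarith [dist_triangle x v z]
      simp [this]
    rw [this, setLIntegral_const, ENNReal.mul_div_cancel_right hA.1.ne' hA.2.ne]
  rw [h2] at h1
  -- The exponent `4` comes from `8r + d(y,z) ≤ 12r ≤ 2^4 r`.
  have h3 : (∫⁻ v in ball z r, g v ∂μ) / μ (ball z r) ≤ ENNReal.ofReal c ^ 4 * m :=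
    hd.div_measure_le hr 4 (by linarith) hsub hB.1 hB.2 g
  have h4 := hd.mean_sub_le_tsum hb hβ hu hg y hR0
  rw [← hT] at h4
  have h5 := hrd.tsum_mean_le_rieszPotential hb hcσ hβ hσ hg.1 y hR0 hR
  rw [← hT] at h5
  calc ENNReal.ofReal |u y|
      ≤ ENNReal.ofReal (2 ^ β) * (1 + ENNReal.ofReal c) * T +
        ENNReal.ofReal ((2 * (8 * r)) ^ β) * (ENNReal.ofReal c ^ 4 * m + m) := by
        refine h1.trans ?_
        gcongr
    _ = ENNReal.ofReal (2 ^ β) * (1 + ENNReal.ofReal c) * T +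
        ENNReal.ofReal (2 ^ β) * (ENNReal.ofReal c ^ 4 + 1) *
          (ENNReal.ofReal ((8 * r) ^ β) * m) := by
        rw [Real.mul_rpow (by norm_num) hR0.le, ENNReal.ofReal_mul (by positivity)]
        ring
    _ ≤ ENNReal.ofReal (2 ^ β) * (1 + ENNReal.ofReal c) * T +
        ENNReal.ofReal (2 ^ β) * (ENNReal.ofReal c ^ 4 + 1) * T := by gcongr
    _ = ENNReal.ofReal (2 ^ β) * (2 + ENNReal.ofReal c + ENNReal.ofReal c ^ 4) * T := by ring
    _ ≤ ENNReal.ofReal (2 ^ β) * (2 + ENNReal.ofReal c + ENNReal.ofReal c ^ 4) *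
        (ENNReal.ofReal cσ * geomSum (σ - β) * rieszPotential μ β g y) := by gcongr
    _ = _ := by rw [pointwiseConst]; ring

theorem rieszPotential_const_mul [OpensMeasurableSpace X] (β : ℝ) (a : ℝ≥0∞) {f : X → ℝ≥0∞}
    (hf : Measurable f) (y : X) :
    rieszPotential μ β (fun z => a * f z) y = a * rieszPotential μ β f y := by
  rw [rieszPotential_eq, rieszPotential_eq,
    ← lintegral_const_mul _ (measurable_mul_rieszKernel β hf y)]
  simp only [mul_assoc]

theorem rieszCapacity_le_mul_hajlaszCapacity [OpensMeasurableSpace X] [ConnectedSpace X]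
    (hb : BallsPosFinite μ) (hd : IsDoublingWith μ c) {cσ σ β p : ℝ}
    (hrd : IsReverseDoublingWith μ cσ σ) (hcσ : 0 < cσ) (hβ : 0 < β) (hσ : β < σ) (hp : 1 < p)
    {x : X} {r : ℝ} (hr : 0 < r) (hdiam : ENNReal.ofReal r < ediam (univ : Set X) / 8)
    {F : Set X} (hF : F ⊆ closedBall x r) {C : ℝ≥0∞}
    (hC : pointwiseConst c cσ σ β ^ p ≤ C) :
    C⁻¹ * rieszCapacity μ β p F ≤ hajlaszCapacity μ β p F (ball x (2 * r)) := by
  have hp0 : 0 < p := by linarith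
  refine le_iInf₂ fun u hu => le_iInf₂ fun g hg => ?_
  rw [mul_comm, ← div_eq_mul_inv]
  refine ENNReal.div_le_of_le_mul' ?_
  set K := pointwiseConst c cσ σ β
  calc rieszCapacity μ β p F ≤ ∫⁻ z, (K * g z) ^ p ∂μ := by
        refine iInf₂_le (fun z => K * g z) ⟨hg.1.const_mul K, fun y hy => ?_⟩
        rw [rieszPotential_const_mul β K hg.1]
        refine le_trans ?_ (ofReal_abs_le_rieszPotential hb hd hrd hcσ hβ hσ hr hdiam
          (mem_closedBall'.1 (hF hy)) hu.1 hu.2.2 hg)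
        rw [← ENNReal.ofReal_one]
        exact ENNReal.ofReal_le_ofReal ((hu.2.1 y hy).trans (le_abs_self _))
    _ = K ^ p * ∫⁻ z, g z ^ p ∂μ := by
        simp only [ENNReal.mul_rpow_of_nonneg _ _ hp0.le]
        rw [lintegral_const_mul _ (hg.1.pow_const p)]
    _ ≤ _ := by gcongr

end LowerBound

/-! ### The Hajłasz capacity is bounded by the Riesz capacity. -/

section UpperBound

/-- The constant in the maximal theorem on `L^p`. -/
noncomputable def maximalConst (c p : ℝ) : ℝ≥0∞ :=
  ENNReal.ofReal p * (2 * ENNReal.ofReal c ^ 3) * (ENNReal.ofReal (p - 1))⁻¹ * 2 ^ (p - 1)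

/-- The constant in the gradient bound for Riesz potentials. -/
noncomputable def gradientConst (c cK β η : ℝ) : ℝ≥0∞ :=
  ENNReal.ofReal c * (geomSum β * ENNReal.ofReal (2 ^ β) + ENNReal.ofReal cK * geomSum (η - β))

/-- The constant in the bound for the far part of a Riesz potential. -/
noncomputable def farConst (c cσ σ β p : ℝ) : ℝ≥0∞ :=
  ENNReal.ofReal c * ENNReal.ofReal (cσ ^ (1 / p)) * geomSum (σ / p - β) *
    ENNReal.ofReal (2 ^ (β - σ / p))

/-- The constant in the `L^p` bound for Riesz potentials on balls. -/
noncomputable def potentialConst (c cσ σ β p : ℝ) : ℝ≥0∞ :=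
  2 ^ (p - 1) * ((ENNReal.ofReal c * geomSum β) ^ p * maximalConst c p +
    farConst c cσ σ β p ^ p * ENNReal.ofReal c ^ 2)

/-- The constant in the capacity bound for bounded test functions. -/
noncomputable def capacityConst (c cK cσ σ β η p : ℝ) : ℝ≥0∞ :=
  2 ^ (p - 1) * (gradientConst c cK β η ^ p * maximalConst c p + potentialConst c cσ σ β p)

theorem gradientConst_ne_top {c cK β η : ℝ} (hβ : 0 < β) (hη : β < η) :
    gradientConst c cK β η ≠ ∞ := by
  have := geomSum_ne_top hβ
  have := geomSum_ne_top (sub_pos.2 hη)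
  unfold gradientConst
  finiteness

theorem maximalConst_ne_top {c p : ℝ} (hp : 1 < p) : maximalConst c p ≠ ∞ := by
  have h : ENNReal.ofReal (p - 1) ≠ 0 := by simpa using hp
  have h2 : (2 : ℝ≥0∞) ^ (p - 1) ≠ ∞ := ENNReal.rpow_ne_top_of_nonneg (by linarith) (by simp)
  unfold maximalConst
  finiteness

/-- The hypothesis `βp < σ` makes the far-part series with ratio `2^(-(σ/p - β))` converge. -/
theorem potentialConst_ne_top {c cσ σ β p : ℝ} (hβ : 0 < β) (hp : 1 < p) (hσ : β * p < σ) :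
    potentialConst c cσ σ β p ≠ ∞ := by
  have hp0 : 0 < p := by linarith
  have h1 := geomSum_ne_top hβ
  have h2 := geomSum_ne_top (sub_pos.2 ((lt_div_iff₀ hp0).2 hσ))
  have h3 := maximalConst_ne_top (c := c) hp
  have h4 : (2 : ℝ≥0∞) ^ (p - 1) ≠ ∞ := ENNReal.rpow_ne_top_of_nonneg (by linarith) (by simp)
  have h5 : (ENNReal.ofReal c * geomSum β) ^ p ≠ ∞ :=
    ENNReal.rpow_ne_top_of_nonneg hp0.le (by finiteness)
  have h6 : farConst c cσ σ β p ^ p ≠ ∞ :=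
    ENNReal.rpow_ne_top_of_nonneg hp0.le (by unfold farConst; finiteness)
  unfold potentialConst
  finiteness

theorem capacityConst_ne_top {c cK cσ σ β η p : ℝ} (hβ : 0 < β) (hη : β < η) (hp : 1 < p)
    (hσ : β * p < σ) : capacityConst c cK cσ σ β η p ≠ ∞ := by
  have h1 := potentialConst_ne_top (c := c) (cσ := cσ) hβ hp hσ
  have h3 := maximalConst_ne_top (c := c) hp
  have h4 : (2 : ℝ≥0∞) ^ (p - 1) ≠ ∞ := ENNReal.rpow_ne_top_of_nonneg (by linarith) (by simp)
  have h5 : gradientConst c cK β η ^ p ≠ ∞ :=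
    ENNReal.rpow_ne_top_of_nonneg (by linarith) (gradientConst_ne_top hβ hη)
  unfold capacityConst
  finiteness

/-- The Riesz potential of a bounded function vanishing outside a ball is locally bounded. -/
theorem IsDoublingWith.rieszPotential_le_of_support [OpensMeasurableSpace X]
    (hb : BallsPosFinite μ) (hd : IsDoublingWith μ c) {β : ℝ} (hβ : 0 < β) {h : X → ℝ≥0∞}
    (hh : Measurable h) {b : ℝ≥0∞} (hhb : ∀ z, h z ≤ b) {x : X} {R : ℝ}
    (hR : 0 < R) (hsupp : ∀ z ∉ ball x R, h z = 0) {y : X} {s : ℝ} (hy : dist x y ≤ s) :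
    rieszPotential μ β h y ≤
      ENNReal.ofReal c * geomSum β * ENNReal.ofReal ((R + s) ^ β) * b := by
  have hs : 0 ≤ s := dist_nonneg.trans hy
  have h1 := hd.setLIntegral_ball_mul_rieszKernel_le hb hβ hh y (R := R + s) (by positivity)
  have hsub : ball x R ⊆ ball y (R + s) := ball_subset_ball' (by linarith)
  rw [rieszPotential_eq]
  calc ∫⁻ z, h z * rieszKernel μ β y z ∂μ
      = ∫⁻ z in ball y (R + s), h z * rieszKernel μ β y z ∂μ := by
        rw [← lintegral_indicator measurableSet_ball]
        refine lintegral_congr fun z => ?_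
        by_cases hz : z ∈ ball y (R + s)
        · simp [hz]
        · simp [hz, hsupp z fun hzx => hz (hsub hzx)]
    _ ≤ _ := h1.trans (by gcongr; exact maximalFunction_le hhb y)

theorem IsDoublingWith.abs_toReal_rieszPotential_sub_le [OpensMeasurableSpace X]
    (hb : BallsPosFinite μ) (hd : IsDoublingWith μ c) {β η cK : ℝ} (hβ : 0 < β) (hη : β < η)
    (hcK : 0 < cK) (hk : KernelEstimate μ β η cK) {h : X → ℝ≥0∞} (hh : Measurable h)
    (ht : ∀ y, rieszPotential μ β h y ≠ ∞) (hM : ∀ y, maximalFunction μ h y ≠ ∞) (y w : X) :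
    |(rieszPotential μ β h y).toReal - (rieszPotential μ β h w).toReal| ≤
      dist y w ^ β * ((gradientConst c cK β η * maximalFunction μ h y).toReal +
        (gradientConst c cK β η * maximalFunction μ h w).toReal) := by
  have hg := gradientConst_ne_top (c := c) (cK := cK) hβ hη
  have key : ∀ y w : X, (rieszPotential μ β h y).toReal ≤ (rieszPotential μ β h w).toReal +
      dist y w ^ β * (gradientConst c cK β η * maximalFunction μ h y).toReal := by
    intro y w
    have h1 := hd.rieszPotential_le_add hb hβ hη hcK hk hh y w
    rw [← gradientConst, mul_assoc, mul_left_comm] at h1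
    have h2 := ENNReal.toReal_mono (ENNReal.add_ne_top.2 ⟨ht w, ENNReal.mul_ne_top
      ENNReal.ofReal_ne_top (ENNReal.mul_ne_top hg (hM y))⟩) h1
    rwa [ENNReal.toReal_add (ht w) (ENNReal.mul_ne_top ENNReal.ofReal_ne_top
      (ENNReal.mul_ne_top hg (hM y))), ENNReal.toReal_mul,
      ENNReal.toReal_ofReal (by positivity)] at h2
  have h1 := key y w
  have h2 := key w y
  rw [dist_comm w y] at h2
  have h3 : 0 ≤ dist y w ^ β * (gradientConst c cK β η * maximalFunction μ h y).toReal := by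
    positivity
  have h4 : 0 ≤ dist y w ^ β * (gradientConst c cK β η * maximalFunction μ h w).toReal := by
    positivity
  rw [abs_le]
  constructor <;> linarith

/-- A bounded `h` has a bounded maximal function, so the gradient bound becomes a Hölder bound.
Continuity makes superlevel sets of the potential open for the compactness argument. -/
theorem IsDoublingWith.continuous_rieszPotential [OpensMeasurableSpace X]
    (hb : BallsPosFinite μ) (hd : IsDoublingWith μ c) {β η cK : ℝ} (hβ : 0 < β) (hη : β < η)
    (hcK : 0 < cK) (hk : KernelEstimate μ β η cK) {h : X → ℝ≥0∞} (hh : Measurable h)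
    (ht : ∀ y, rieszPotential μ β h y ≠ ∞) {b : ℝ≥0∞} (hbt : b ≠ ∞) (hhb : ∀ z, h z ≤ b) :
    Continuous (rieszPotential μ β h) := by
  have hg := gradientConst_ne_top (c := c) (cK := cK) hβ hη
  have hMb : ∀ y, maximalFunction μ h y ≤ b := maximalFunction_le hhb
  have hle : ∀ y, (gradientConst c cK β η * maximalFunction μ h y).toReal ≤
      (gradientConst c cK β η * b).toReal := fun y =>
    ENNReal.toReal_mono (ENNReal.mul_ne_top hg hbt) (by gcongr; exact hMb y)
  have hLip : (fun y => (rieszPotential μ β h y).toReal) ∈ LipBeta X β := by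
    refine ⟨2 * (gradientConst c cK β η * b).toReal, by positivity, fun y w => ?_⟩
    refine (hd.abs_toReal_rieszPotential_sub_le hb hβ hη hcK hk hh ht
      (fun y => ((hMb y).trans_lt hbt.lt_top).ne) y w).trans ?_
    rw [mul_comm]
    gcongr
    linarith [hle y, hle w]
  have h1 := ENNReal.continuous_ofReal.comp (LipBeta.continuous hβ hLip)
  refine h1.congr fun y => ?_
  simp [ht y]

/-- The `L^p` bound for Riesz potentials on a ball. -/
theorem IsDoublingWith.setLIntegral_rieszPotential_rpow_le [OpensMeasurableSpace X]
    [SecondCountableTopology X] (hb : BallsPosFinite μ) (hd : IsDoublingWith μ c)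
    {cσ σ β p : ℝ} (hcσ : 0 < cσ) (hrd : IsReverseDoublingWith μ cσ σ) (hβ : 0 < β) (hp : 1 < p)
    {h : X → ℝ≥0∞} (hh : Measurable h) {b : ℝ≥0∞} (hbt : b ≠ ∞) (hhb : ∀ z, h z ≤ b)
    (x : X) {r : ℝ} (hr : 0 < r) :
    ∫⁻ y in ball x (2 * r), (ENNReal.ofReal (r ^ (-β)) * rieszPotential μ β h y) ^ p ∂μ ≤
      potentialConst c cσ σ β p * ∫⁻ y, h y ^ p ∂μ := by
  have hp0 : 0 < p := by linarith
  have hpi : 0 < 1 / p := by positivity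
  set A := ENNReal.ofReal c * geomSum β with hA
  set K := farConst c cσ σ β p with hK
  set V := μ (ball x (2 * r)) with hV
  set J := ∫⁻ y, h y ^ p ∂μ with hJ
  have hVp := hb x (2 * r) (by positivity)
  rw [← hV] at hVp
  set B := K * (ENNReal.ofReal c ^ 2 * V⁻¹) ^ (1 / p) * J ^ (1 / p) with hB
  have hrr : ENNReal.ofReal (r ^ (-β)) * ENNReal.ofReal (r ^ β) = 1 := by
    rw [← ENNReal.ofReal_mul (by positivity), ← Real.rpow_add hr]; simp
  have hpt : ∀ y ∈ ball x (2 * r), ENNReal.ofReal (r ^ (-β)) * rieszPotential μ β h y ≤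
      A * maximalFunction μ h y + B := by
    intro y hy
    rw [mem_ball'] at hy
    have hyr := hb y r hr
    have h1 := hd.setLIntegral_ball_mul_rieszKernel_le hb hβ hh y hr
    have h2 := hd.setLIntegral_compl_ball_mul_rieszKernel_le hb hcσ hrd hβ hp hh y hr
    have h3 : (μ (ball y r))⁻¹ ≤ ENNReal.ofReal c ^ 2 * V⁻¹ := by
      rw [← div_eq_mul_inv, ENNReal.le_div_iff_mul_le (Or.inl hVp.1.ne') (Or.inl hVp.2.ne),
        mul_comm, ← div_eq_mul_inv]
      exact ENNReal.div_le_of_le_mul (hd.measure_ball_le hr 2 (by linarith))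
    have h4 : μ (ball y r) ^ (-(1 / p)) ≤ (ENNReal.ofReal c ^ 2 * V⁻¹) ^ (1 / p) := by
      rw [ENNReal.rpow_neg, ← ENNReal.inv_rpow]
      gcongr
    have h5 : rieszPotential μ β h y ≤
        ENNReal.ofReal (r ^ β) * (A * maximalFunction μ h y + B) := by
      rw [rieszPotential_eq, ← lintegral_add_compl _ (measurableSet_ball (x := y) (ε := r))]
      refine (add_le_add h1 (h2.trans (mul_le_mul' (mul_le_mul' le_rfl h4) le_rfl))).trans
        (le_of_eq ?_)
      rw [hB, hK, farConst]
      ring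
    calc ENNReal.ofReal (r ^ (-β)) * rieszPotential μ β h y
        ≤ ENNReal.ofReal (r ^ (-β)) *
          (ENNReal.ofReal (r ^ β) * (A * maximalFunction μ h y + B)) := by gcongr
      _ = _ := by rw [← mul_assoc, hrr, one_mul]
  -- The far part is bounded by a constant on the ball, of size `(J / V)^(1/p)`; integrating its
  -- `p`-th power over `B(x,2r)` cancels the volume.
  have hBp : B ^ p * V = K ^ p * ENNReal.ofReal c ^ 2 * J := by
    rw [hB, ENNReal.mul_rpow_of_nonneg _ _ hp0.le, ENNReal.mul_rpow_of_nonneg _ _ hp0.le,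
      ← ENNReal.rpow_mul, ← ENNReal.rpow_mul, one_div_mul_cancel hp0.ne', ENNReal.rpow_one,
      ENNReal.rpow_one]
    calc _ = K ^ p * ENNReal.ofReal c ^ 2 * J * (V⁻¹ * V) := by ring
      _ = _ := by rw [ENNReal.inv_mul_cancel hVp.1.ne' hVp.2.ne, mul_one]
  have hMm : Measurable fun y => maximalFunction μ h y ^ p :=
    (measurable_maximalFunction h).pow_const p
  have hmax := hd.lintegral_maximalFunction_rpow_le hb hp hh hbt hhb
  rw [← maximalConst] at hmax
  calc ∫⁻ y in ball x (2 * r), (ENNReal.ofReal (r ^ (-β)) * rieszPotential μ β h y) ^ p ∂μ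
      ≤ ∫⁻ y in ball x (2 * r), 2 ^ (p - 1) * (A ^ p * maximalFunction μ h y ^ p + B ^ p) ∂μ := by
        refine setLIntegral_mono' measurableSet_ball fun y hy => ?_
        refine (ENNReal.rpow_le_rpow (hpt y hy) hp0.le).trans ?_
        refine (ENNReal.rpow_add_le_mul_rpow_add_rpow _ _ hp.le).trans ?_
        rw [ENNReal.mul_rpow_of_nonneg _ _ hp0.le]
    _ = 2 ^ (p - 1) * (A ^ p * ∫⁻ y in ball x (2 * r), maximalFunction μ h y ^ p ∂μ +
          B ^ p * V) := by
        rw [lintegral_const_mul _ ((hMm.const_mul _).add_const _),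
          lintegral_add_left (hMm.const_mul _), lintegral_const_mul _ hMm, setLIntegral_const]
    _ ≤ 2 ^ (p - 1) * (A ^ p * (maximalConst c p * J) + K ^ p * ENNReal.ofReal c ^ 2 * J) := by
        rw [hBp]
        have := (setLIntegral_le_lintegral (ball x (2 * r))
          (fun y => maximalFunction μ h y ^ p)).trans hmax
        gcongr
    _ = _ := by rw [potentialConst]; ring

/-- The radial cutoff function equal to `1` on `B (x, r)` and to `0` outside `B (x, 2 * r)`. -/
noncomputable def cutoff {Y : Type*} [MetricSpace Y] (x : Y) (r : ℝ) (y : Y) : ℝ :=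
  max 0 (min 1 (2 - dist x y / r))

theorem cutoff_nonneg {Y : Type*} [MetricSpace Y] (x : Y) (r : ℝ) (y : Y) : 0 ≤ cutoff x r y :=
  le_max_left _ _

theorem cutoff_le_one {Y : Type*} [MetricSpace Y] (x : Y) (r : ℝ) (y : Y) : cutoff x r y ≤ 1 :=
  max_le zero_le_one (min_le_left _ _)

theorem cutoff_eq_one {Y : Type*} [MetricSpace Y] {x y : Y} {r : ℝ} (hr : 0 < r)
    (h : dist x y ≤ r) : cutoff x r y = 1 := by
  have : dist x y / r ≤ 1 := (div_le_one hr).2 h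
  rw [cutoff, min_eq_left (by linarith), max_eq_right zero_le_one]

theorem cutoff_eq_zero {Y : Type*} [MetricSpace Y] {x y : Y} {r : ℝ} (hr : 0 < r)
    (h : y ∉ ball x (2 * r)) : cutoff x r y = 0 := by
  rw [mem_ball', not_lt] at h
  have : 2 ≤ dist x y / r := (le_div_iff₀ hr).2 h
  rw [cutoff, max_eq_left]
  exact (min_le_right _ _).trans (by linarith)

theorem abs_cutoff_sub_le {Y : Type*} [MetricSpace Y] (x : Y) {r β : ℝ} (hr : 0 < r)
    (hβ : 0 < β) (hβ1 : β ≤ 1) (a b : Y) :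
    |cutoff x r a - cutoff x r b| ≤ r ^ (-β) * dist a b ^ β := by
  have h1 : |cutoff x r a - cutoff x r b| ≤ dist a b / r := by
    have e1 : |cutoff x r a - cutoff x r b| ≤ |(2 - dist x a / r) - (2 - dist x b / r)| := by
      refine (abs_max_sub_max_le_max _ _ _ _).trans ?_
      rw [sub_self, abs_zero]
      refine max_le (abs_nonneg _) ((abs_min_sub_min_le_max _ _ _ _).trans ?_)
      rw [sub_self, abs_zero]
      exact max_le (abs_nonneg _) le_rfl
    refine e1.trans ?_
    rw [show (2 - dist x a / r) - (2 - dist x b / r) = (dist b x - dist a x) / r by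
      rw [dist_comm b x, dist_comm a x]; ring, abs_div, abs_of_pos hr, dist_comm a b]
    gcongr
    exact abs_dist_sub_le b a x
  have h2 : |cutoff x r a - cutoff x r b| ≤ 1 := by
    rw [abs_le]
    constructor <;> linarith [cutoff_nonneg x r a, cutoff_nonneg x r b, cutoff_le_one x r a,
      cutoff_le_one x r b]
  have h3 : r ^ (-β) * dist a b ^ β = (dist a b / r) ^ β := by
    rw [Real.div_rpow dist_nonneg hr.le, Real.rpow_neg hr.le]; field_simp
  rw [h3]
  -- For `t = d(a,b)/r`, the Lipschitz bound `t` is at most `t^β` when `t ≤ 1`, as `β ≤ 1`;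
  -- otherwise the trivial bound `1` is at most `t^β`.
  rcases le_total (dist a b / r) 1 with h | h
  · refine h1.trans ?_
    rcases eq_or_lt_of_le (show 0 ≤ dist a b / r by positivity) with h0 | h0
    · rw [← h0, Real.zero_rpow hβ.ne']
    · simpa using Real.rpow_le_rpow_of_exponent_ge h0 h hβ1
  · exact h2.trans (Real.one_le_rpow h hβ.le)

/-- Leibniz rule: the test function is the potential times the cutoff, `K M h` accounts for the
variation of the potential and `D` for that of the cutoff. Boundedness and bounded support of `h`
keep everything finite and make the product Hölder. -/
theorem hajlaszCapacity_le_of_bounded [OpensMeasurableSpace X]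
    [SecondCountableTopology X] (hb : BallsPosFinite μ) (hd : IsDoublingWith μ c)
    {cσ σ cK η β p : ℝ} (hcσ : 0 < cσ) (hrd : IsReverseDoublingWith μ cσ σ) (hβ : 0 < β)
    (hβ1 : β ≤ 1) (hp : 1 < p) (hη : β < η) (hcK : 0 < cK) (hk : KernelEstimate μ β η cK)
    {x : X} {r : ℝ} (hr : 0 < r) {F : Set X} (hF : F ⊆ closedBall x r)
    {h : X → ℝ≥0∞} (hh : Measurable h) {b : ℝ≥0∞} (hbt : b ≠ ∞) (hhb : ∀ z, h z ≤ b) {R : ℝ}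
    (hR : 0 < R) (hsupp : ∀ z ∉ ball x R, h z = 0) (hF1 : ∀ y ∈ F, 1 ≤ rieszPotential μ β h y) :
    hajlaszCapacity μ β p F (ball x (2 * r)) ≤
      capacityConst c cK cσ σ β η p * ∫⁻ z, h z ^ p ∂μ := by
  have hp0 : 0 < p := by linarith
  set I := rieszPotential μ β h with hI
  set M := maximalFunction μ h with hM
  set K := gradientConst c cK β η with hK
  have hg : K ≠ ∞ := gradientConst_ne_top hβ hη
  have hGβ := geomSum_ne_top hβ
  have hIt : ∀ y, I y ≠ ∞ := fun y => ne_top_of_le_ne_top (by finiteness)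
    (hd.rieszPotential_le_of_support hb hβ hh hhb hR hsupp (le_refl (dist x y)))
  have hMb : ∀ y, M y ≤ b := maximalFunction_le hhb
  have hMt : ∀ y, M y ≠ ∞ := fun y => ne_top_of_le_ne_top hbt (hMb y)
  have hIc : Continuous I := hd.continuous_rieszPotential hb hβ hη hcK hk hh hIt hbt hhb
  set D : X → ℝ≥0∞ := (ball x (2 * r)).indicator
    (fun y => ENNReal.ofReal (r ^ (-β)) * I y) with hD
  have hDm : Measurable D := (hIc.measurable.const_mul _).indicator measurableSet_ball
  have hMm : Measurable M := measurable_maximalFunction h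
  set B := ENNReal.ofReal (r ^ (-β)) *
    (ENNReal.ofReal c * geomSum β * ENNReal.ofReal ((R + 2 * r) ^ β) * b) with hB
  have hBt : B ≠ ∞ := by finiteness
  have hDB : ∀ y, D y ≤ B := by
    intro y
    by_cases hy : y ∈ ball x (2 * r)
    · simp only [hD, hy, indicator_of_mem]
      exact mul_le_mul' le_rfl
        (hd.rieszPotential_le_of_support hb hβ hh hhb hR hsupp (mem_ball'.1 hy).le)
    · simp [hD, hy]
  set G : X → ℝ≥0∞ := fun y => K * M y + D y with hG
  have hGt : ∀ y, G y ≠ ∞ := fun y => ENNReal.add_ne_top.2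
    ⟨ENNReal.mul_ne_top hg (hMt y), ne_top_of_le_ne_top hBt (hDB y)⟩
  have hGr : ∀ y, (G y).toReal = (K * M y).toReal + (D y).toReal := fun y =>
    ENNReal.toReal_add (ENNReal.mul_ne_top hg (hMt y)) (ne_top_of_le_ne_top hBt (hDB y))
  have hDr : ∀ y ∈ ball x (2 * r), (D y).toReal = r ^ (-β) * (I y).toReal := by
    intro y hy
    simp only [hD, hy, indicator_of_mem]
    rw [ENNReal.toReal_mul, ENNReal.toReal_ofReal (by positivity)]
  set u : X → ℝ := fun y => (I y).toReal * cutoff x r y with hu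
  have key : ∀ a w, |u a - u w| ≤ dist a w ^ β * ((G a).toReal + (G w).toReal) := by
    intro a w
    have hIaw := hd.abs_toReal_rieszPotential_sub_le hb hβ hη hcK hk hh hIt hMt a w
    have hφ := abs_cutoff_sub_le x hr hβ hβ1 a w
    have hδ : 0 ≤ dist a w ^ β := by positivity
    have hφa0 := cutoff_nonneg x r a
    have hφa1 := cutoff_le_one x r a
    have hIa : 0 ≤ (I a).toReal := ENNReal.toReal_nonneg
    have hIw : 0 ≤ (I w).toReal := ENNReal.toReal_nonneg
    have hnn : ∀ t : ℝ≥0∞, 0 ≤ t.toReal := fun t => ENNReal.toReal_nonneg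
    rw [hGr, hGr]
    -- `D` vanishes outside the ball, so the difference of cutoffs must be multiplied by the
    -- potential at a point inside it: `w` if possible, otherwise `a`. If both points are outside,
    -- the product is zero at each.
    by_cases hw : w ∈ ball x (2 * r)
    · calc |u a - u w| = |((I a).toReal - (I w).toReal) * cutoff x r a +
            (I w).toReal * (cutoff x r a - cutoff x r w)| := by simp only [hu]; ring_nf
        _ ≤ |(I a).toReal - (I w).toReal| * 1 +
            (I w).toReal * (r ^ (-β) * dist a w ^ β) := by
            refine (abs_add_le _ _).trans ?_
            rw [abs_mul, abs_mul, abs_of_nonneg hφa0, abs_of_nonneg hIw]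
            gcongr
        _ ≤ dist a w ^ β * ((K * M a).toReal + (K * M w).toReal) +
            dist a w ^ β * (D w).toReal := by
            rw [hDr w hw]
            refine add_le_add (by rw [mul_one]; exact hIaw) (le_of_eq (by ring))
        _ ≤ _ := by
            rw [← mul_add]
            exact mul_le_mul_of_nonneg_left (by linarith [hnn (D a)]) hδ
    · have hw0 : cutoff x r w = 0 := cutoff_eq_zero hr hw
      by_cases ha : a ∈ ball x (2 * r)
      · calc |u a - u w| = (I a).toReal * |cutoff x r a - cutoff x r w| := by
              simp only [hu, hw0, mul_zero, sub_zero, abs_mul, abs_of_nonneg hIa]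
          _ ≤ (I a).toReal * (r ^ (-β) * dist a w ^ β) := by gcongr
          _ = dist a w ^ β * (D a).toReal := by rw [hDr a ha]; ring
          _ ≤ _ := mul_le_mul_of_nonneg_left
              (by linarith [hnn (K * M a), hnn (K * M w), hnn (D w)]) hδ
      · have ha0 : cutoff x r a = 0 := cutoff_eq_zero hr ha
        simp only [hu, hw0, ha0, mul_zero, sub_zero, abs_zero]
        positivity
  have huLip : u ∈ LipBeta X β := by
    refine ⟨2 * (K * b + B).toReal, by positivity, fun a w => (key a w).trans ?_⟩
    have hle : ∀ y, (G y).toReal ≤ (K * b + B).toReal := fun y =>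
      ENNReal.toReal_mono (by finiteness) (add_le_add (by gcongr; exact hMb y) (hDB y))
    rw [mul_comm]
    gcongr
    linarith [hle a, hle w]
  have hGm : Measurable G := (hMm.const_mul _).add hDm
  have huG : IsHajlaszGradient μ β u G := by
    refine ⟨hGm, ∅, measure_empty, fun a _ w _ => ?_⟩
    refine (ENNReal.ofReal_le_ofReal (key a w)).trans (le_of_eq ?_)
    rw [ENNReal.ofReal_mul (by positivity), ENNReal.ofReal_add (by positivity) (by positivity),
      ENNReal.ofReal_toReal (hGt a), ENNReal.ofReal_toReal (hGt w)]
  have huF : ∀ y ∈ F, 1 ≤ u y := by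
    intro y hy
    simp only [hu]
    rw [cutoff_eq_one hr (mem_closedBall'.1 (hF hy)), mul_one]
    simpa using ENNReal.toReal_mono (hIt y) (hF1 y hy)
  have hu0 : ∀ y ∉ ball x (2 * r), u y = 0 := fun y hy => by
    simp only [hu, cutoff_eq_zero hr hy, mul_zero]
  have hmax := hd.lintegral_maximalFunction_rpow_le hb hp hh hbt hhb
  rw [← maximalConst] at hmax
  have hpot := hd.setLIntegral_rieszPotential_rpow_le hb hcσ hrd hβ hp hh hbt hhb x hr
  have hDp : ∫⁻ y, D y ^ p ∂μ = ∫⁻ y in ball x (2 * r),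
      (ENNReal.ofReal (r ^ (-β)) * rieszPotential μ β h y) ^ p ∂μ := by
    rw [← lintegral_indicator measurableSet_ball]
    refine lintegral_congr fun y => ?_
    by_cases hy : y ∈ ball x (2 * r)
    · simp [hD, hy, hI]
    · simp [hD, hy, hp0]
  refine (iInf₂_le_of_le u ⟨huLip, huF, hu0⟩ (iInf₂_le G huG)).trans ?_
  calc ∫⁻ y, G y ^ p ∂μ ≤ ∫⁻ y, 2 ^ (p - 1) * (K ^ p * M y ^ p + D y ^ p) ∂μ := by
        refine lintegral_mono fun y => ?_
        refine (ENNReal.rpow_add_le_mul_rpow_add_rpow _ _ hp.le).trans ?_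
        rw [ENNReal.mul_rpow_of_nonneg _ _ hp0.le]
    _ = 2 ^ (p - 1) * (K ^ p * ∫⁻ y, M y ^ p ∂μ + ∫⁻ y, D y ^ p ∂μ) := by
        have hMp := hMm.pow_const p
        have hGp : Measurable fun y => K ^ p * M y ^ p + D y ^ p :=
          (hMp.const_mul _).add (hDm.pow_const p)
        rw [lintegral_const_mul _ hGp,
          lintegral_add_left (hMp.const_mul _), lintegral_const_mul _ hMp]
    _ ≤ 2 ^ (p - 1) * (K ^ p * (maximalConst c p * ∫⁻ z, h z ^ p ∂μ) +
          potentialConst c cσ σ β p * ∫⁻ z, h z ^ p ∂μ) := by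
        rw [hDp]
        gcongr
    _ = _ := by rw [capacityConst]; ring

/-- Truncation of a function in height and to a ball. -/
noncomputable def truncation {Y : Type*} [MetricSpace Y] (x : Y) (f : Y → ℝ≥0∞) (n : ℕ) :
    Y → ℝ≥0∞ :=
  (ball x (n + 1)).indicator fun z => min (f z) n

theorem measurable_truncation [OpensMeasurableSpace X] (x : X) {f : X → ℝ≥0∞} (hf : Measurable f)
    (n : ℕ) : Measurable (truncation x f n) :=
  (hf.min measurable_const).indicator measurableSet_ball

theorem monotone_truncation {Y : Type*} [MetricSpace Y] (x : Y) (f : Y → ℝ≥0∞) :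
    Monotone (truncation x f) := by
  intro m n hmn z
  refine (indicator_le_indicator_of_subset (ball_subset_ball (by gcongr))
    (fun _ => zero_le) z).trans
    (indicator_le_indicator ?_)
  gcongr

theorem iSup_truncation {Y : Type*} [MetricSpace Y] (x : Y) (f : Y → ℝ≥0∞) (z : Y) :
    ⨆ n, truncation x f n z = f z := by
  refine le_antisymm (iSup_le fun n => ?_) (le_of_forall_lt fun t ht => ?_)
  · exact indicator_le_self' (fun _ _ => zero_le) z |>.trans (min_le_left _ _)
  · obtain ⟨n, hn⟩ := ENNReal.exists_nat_gt ht.ne_top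
    obtain ⟨m, hm⟩ := exists_nat_gt (dist z x)
    refine lt_iSup_iff.2 ⟨max n m, ?_⟩
    have hz : z ∈ ball x ((max n m : ℕ) + 1) := by
      rw [mem_ball]
      have : (m : ℝ) ≤ (max n m : ℕ) := by exact_mod_cast le_max_right n m
      linarith
    rw [truncation, indicator_of_mem hz]
    exact lt_min ht (hn.trans_le (by exact_mod_cast le_max_left n m))

theorem rieszPotential_mono (β : ℝ) {f g : X → ℝ≥0∞} (h : f ≤ g) (y : X) :
    rieszPotential μ β f y ≤ rieszPotential μ β g y := by
  rw [rieszPotential_eq, rieszPotential_eq]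
  exact lintegral_mono fun z => by gcongr; exact h z

theorem rieszPotential_eq_iSup_truncation [OpensMeasurableSpace X] (β : ℝ) (x : X)
    {f : X → ℝ≥0∞} (hf : Measurable f) (y : X) :
    rieszPotential μ β f y = ⨆ n, rieszPotential μ β (truncation x f n) y := by
  simp only [rieszPotential_eq]
  rw [← lintegral_iSup (fun n => measurable_mul_rieszKernel β (measurable_truncation x hf n) y)
    (fun m n hmn z => by
      have := monotone_truncation x f hmn z
      dsimp only
      gcongr)]
  refine lintegral_congr fun z => ?_
  rw [← ENNReal.iSup_mul, iSup_truncation]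

/-- Truncations increase to `f`, and so do their potentials by monotone convergence. The open sets
where the `n`-th potential exceeds `1/2` increase and cover the compact `F`, so one of them contains
`F`; doubling that truncation restores the bound `1` at the cost of `2^p`. -/
theorem hajlaszCapacity_le_mul_lintegral [OpensMeasurableSpace X]
    [SecondCountableTopology X] (hb : BallsPosFinite μ) (hd : IsDoublingWith μ c)
    {cσ σ cK η β p : ℝ} (hcσ : 0 < cσ) (hrd : IsReverseDoublingWith μ cσ σ) (hβ : 0 < β)
    (hβ1 : β ≤ 1) (hp : 1 < p) (hη : β < η) (hcK : 0 < cK) (hk : KernelEstimate μ β η cK)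
    {x : X} {r : ℝ} (hr : 0 < r) {F : Set X} (hF : F ⊆ closedBall x r) (hFc : IsCompact F)
    {f : X → ℝ≥0∞} (hf : Measurable f) (hF1 : ∀ y ∈ F, 1 ≤ rieszPotential μ β f y) :
    hajlaszCapacity μ β p F (ball x (2 * r)) ≤
      capacityConst c cK cσ σ β η p * 2 ^ p * ∫⁻ z, f z ^ p ∂μ := by
  have hp0 : 0 < p := by linarith
  have hGβ := geomSum_ne_top hβ
  have hfn : ∀ n z, truncation x f n z ≤ n := fun n z =>
    (indicator_le_self' (fun _ _ => zero_le) z).trans (min_le_right _ _)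
  have hsupp : ∀ n : ℕ, ∀ z ∉ ball x ((n : ℝ) + 1), truncation x f n z = 0 := fun n z hz =>
    indicator_of_notMem hz _
  have hm : ∀ n, Measurable (truncation x f n) := measurable_truncation x hf
  have ht : ∀ n y, rieszPotential μ β (truncation x f n) y ≠ ∞ := fun n y =>
    ne_top_of_le_ne_top (by finiteness) (hd.rieszPotential_le_of_support hb hβ (hm n) (hfn n)
      (by positivity) (hsupp n) (le_refl (dist x y)))
  have hc : ∀ n, Continuous (rieszPotential μ β (truncation x f n)) := fun n =>
    hd.continuous_rieszPotential hb hβ hη hcK hk (hm n) (ht n) (by finiteness) (hfn n)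
  obtain ⟨n, hn⟩ := hFc.elim_directed_cover
    (fun n => {y | 2⁻¹ < rieszPotential μ β (truncation x f n) y})
    (fun n => isOpen_lt continuous_const (hc n))
    (fun y hy => by
      have h1 : 2⁻¹ < rieszPotential μ β f y :=
        (ENNReal.inv_lt_one.2 ENNReal.one_lt_two).trans_le (hF1 y hy)
      rw [rieszPotential_eq_iSup_truncation β x hf y, lt_iSup_iff] at h1
      exact mem_iUnion.2 h1)
    (Monotone.directed_le fun m n hmn y (hy : _ < _) =>
      hy.trans_le (rieszPotential_mono β (monotone_truncation x f hmn) y))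
  have h2 := hajlaszCapacity_le_of_bounded hb hd hcσ hrd hβ hβ1 hp hη hcK hk hr hF
    (h := fun z => 2 * truncation x f n z) ((hm n).const_mul 2) (b := 2 * n) (by finiteness)
    (fun z => by gcongr; exact hfn n z) (R := n + 1) (by positivity)
    (fun z hz => by simp [hsupp n z hz]) (fun y hy => by
      rw [rieszPotential_const_mul β 2 (hm n)]
      have h1 : 2⁻¹ < rieszPotential μ β (truncation x f n) y := hn hy
      calc (1 : ℝ≥0∞) = 2 * 2⁻¹ := (ENNReal.mul_inv_cancel (by simp) (by simp)).symm
        _ ≤ _ := by gcongr)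
  refine h2.trans ?_
  rw [mul_assoc]
  gcongr
  calc ∫⁻ z, (2 * truncation x f n z) ^ p ∂μ = 2 ^ p * ∫⁻ z, truncation x f n z ^ p ∂μ := by
        simp only [ENNReal.mul_rpow_of_nonneg _ _ hp0.le]
        rw [lintegral_const_mul _ ((hm n).pow_const p)]
    _ ≤ _ := by
        gcongr with z
        rw [← iSup_truncation x f z]
        exact le_iSup (fun n => truncation x f n z) n

end UpperBound

theorem pointwiseConst_ne_top {c cσ σ β : ℝ} (hσ : β < σ) : pointwiseConst c cσ σ β ≠ ∞ := by
  have := geomSum_ne_top (sub_pos.2 hσ)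
  unfold pointwiseConst
  finiteness

end HajlaszRiesz

/-! ### Choice of the constant and conclusion. -/

theorem corollaryc (p β σ η cμ cσ cK : ℝ) (hp : 1 < p) (hβ : 0 < β) (hβ1 : β ≤ 1)
    (hσ : β * p < σ) (hη : β < η) (hcμ : 1 < cμ) (hcσ : 0 < cσ) (hcK : 0 < cK) :
    ∃ C : ℝ, 0 < C ∧
      ∀ (X : Type*) [MetricSpace X] [CompleteSpace X] [ConnectedSpace X] [Nontrivial X]
        [MeasurableSpace X] [OpensMeasurableSpace X] (μ : Measure X) [μ.IsComplete],
        HajlaszRiesz.BallsPosFinite μ →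
        HajlaszRiesz.IsDoublingWith μ cμ →
        HajlaszRiesz.IsReverseDoublingWith μ cσ σ →
        HajlaszRiesz.KernelEstimate μ β η cK →
        ∀ (E : Set X), IsClosed E → ∀ x ∈ E, ∀ r : ℝ, 0 < r →
          ENNReal.ofReal r < ediam (univ : Set X) / 8 →
          ENNReal.ofReal C⁻¹ * HajlaszRiesz.rieszCapacity μ β p (E ∩ closure (ball x r)) ≤
              HajlaszRiesz.hajlaszCapacity μ β p (E ∩ closure (ball x r)) (ball x (2 * r)) ∧
            HajlaszRiesz.hajlaszCapacity μ β p (E ∩ closure (ball x r)) (ball x (2 * r)) ≤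
              ENNReal.ofReal C * HajlaszRiesz.rieszCapacity μ β p (E ∩ closure (ball x r)) := by
  have hp0 : 0 < p := by linarith
  have hσβ : β < σ := by nlinarith
  set K₁ := HajlaszRiesz.pointwiseConst cμ cσ σ β ^ p with hK₁
  set K₂ := HajlaszRiesz.capacityConst cμ cK cσ σ β η p * 2 ^ p with hK₂
  have hK₁t : K₁ ≠ ∞ :=
    ENNReal.rpow_ne_top_of_nonneg hp0.le (HajlaszRiesz.pointwiseConst_ne_top hσβ)
  have hK₂t : K₂ ≠ ∞ := ENNReal.mul_ne_top (HajlaszRiesz.capacityConst_ne_top hβ hη hp hσ)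
    (ENNReal.rpow_ne_top_of_nonneg hp0.le (by simp))
  have hC0 : 0 < (K₁ + K₂).toReal + 1 := by positivity
  have hKC : K₁ + K₂ ≤ ENNReal.ofReal ((K₁ + K₂).toReal + 1) := by
    rw [← ENNReal.ofReal_toReal (ENNReal.add_ne_top.2 ⟨hK₁t, hK₂t⟩)]
    exact ENNReal.ofReal_le_ofReal (by rw [ENNReal.toReal_ofReal (by positivity)]; linarith)
  -- The sum dominates both constants at once, and adding `1` makes it positive; it is fixed before
  -- `X` and `μ`.
  refine ⟨(K₁ + K₂).toReal + 1, hC0, ?_⟩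
  intro X _ _ _ _ _ _ μ _ hb hd hrd hk E hE x hx r hr hdiam
  have : ProperSpace X := hd.properSpace hb
  have hF : E ∩ closure (ball x r) ⊆ closedBall x r :=
    inter_subset_right.trans closure_ball_subset_closedBall
  have hFc : IsCompact (E ∩ closure (ball x r)) :=
    (isCompact_closedBall x r).of_isClosed_subset (hE.inter isClosed_closure) hF
  constructor
  · rw [ENNReal.ofReal_inv_of_pos hC0]
    exact HajlaszRiesz.rieszCapacity_le_mul_hajlaszCapacity hb hd hrd hcσ hβ hσβ hp hr hdiam hF
      (le_self_add.trans hKC)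
  · rw [← ENNReal.div_le_iff' (by simpa using hC0) ENNReal.ofReal_ne_top]
    refine le_iInf₂ fun f hf => ENNReal.div_le_of_le_mul' ?_
    refine (HajlaszRiesz.hajlaszCapacity_le_mul_lintegral hb hd hcσ hrd hβ hβ1 hp hη hcK hk hr hF
      hFc hf.1 hf.2).trans ?_
    gcongr
    exact le_add_self.trans hKC
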